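/- Let $M$ be a Riemann surface with complex structure $J_M$ on its tangent spaces, and let $H=M\times\mathbb H^2$, where $\mathbb H^2$ is a right quaternionic vector space. Right multiplication by $\mathbb C=\mathbb R\oplus\mathbb R i\subset\mathbb H$ turns $H$ into $M\times\mathbb C^4$. For a $1$-form $\omega$ on $M$ put $*\omega(X)=\omega(J_MX)$. All bundles, sections and forms are smooth. For a (complex or quaternionic) line subbundle $V\subset H$ let $\pi_V:H\to H/V$ be the projection and let $\delta_V\in\Omega^1(\mathrm{Hom}(V,H/V))$ be defined by $\delta_V\phi=\pi_V d\phi$ for $\phi\in\Gamma(V)$; $V$ is immersed if $\delta_V(X)=0$ only for $X=0$. A complex line subbundle $E\subset H$, with $J_E$ the right multiplication by $i$, is a holomorphic curve in $\mathbb CP^3$ if $*\delta_E=\delta_EJ_E$. A complex quaternionic line subbundle is a pair $(L,J)$ of a quaternionic line subbundle $L\subset H$ and $J\in\Gamma(\mathrm{End}(L))$, quaternionic linear, with $J^2=-1$; it is a holomorphic curve in $\mathbb HP^1$ if $*\delta_L=\delta_LJ$. The twistor projection of $E$ is $(L,J)$ with $L=E\mathbb H=E\oplus Ej$ and $J$ the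 quaternionic linear extension of $J_E$ to $L$. For a bundle $V$ with complex structure $J$, $K\,\mathrm{End}_-(V)$ denotes the $1$-forms $\omega$ with values in the quaternionic linear endomorphisms of $V$ such that $*\omega=J\omega$ and $\omega J=-J\omega$. (i) Let $E\subset H$ be a complex line subbundle and $(L,J)$ its twistor projection. Then $(L,J)$ is a holomorphic curve if and only if $\tfrac12(\delta_E+*\delta_EJ_E)\in\Omega^1(\mathrm{Hom}(E,L/E))\subset\Omega^1(\mathrm{Hom}(E,H/E))$. Moreover, for every holomorphic curve $(L,J)$ in $\mathbb HP^1$ the formula $\tilde D\psi=\tfrac12(d\psi+*d(J\psi))$ defines an operator $\tilde D:\Gamma(L)\to\Omega^1(L)$, and its $(1,0)$-part $\tfrac12(\tilde D-J{*\tilde D})$ is the form $$A_L=\tfrac12(\tilde D+J\tilde DJ)\in\Gamma(K\,\mathrm{End}_-(L)).$$ (ii) If the twistor projection $(L,J)$ of $E$ is a holomorphic curve, then $\tfrac12(\delta_E+*\delta_EJ_E)=\pi_EA_L|_E$, and $\tfrac12(\delta_E+*\delta_EJ_E)=0$ if and only if $A_L=0$. A complex quaternionic line subbundle $(L,J)$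 is the twistor projection of a holomorphic curve $E$ in $\mathbb CP^3$ if and only if it is a holomorphic curve in $\mathbb HP^1$ with $A_L=0$. (iii) Let $(L,J)$ be an immersed holomorphic curve in $\mathbb HP^1$ with mean curvature sphere congruence $S$ and $J=S|_L$. Here $S\in\Gamma(\mathrm{End}(H))$ is the complex structure on $H$ ($S^2=-1$, quaternionic linear) with $SL=L$, $dS\,L\subset L$, $*\delta_L=\delta_L\circ S=S\circ\delta_L$ and $Q|_L=0$, where $Q=\tfrac14(S\,dS-*dS)$. Then $A=\tfrac14(S\,dS+*dS)\in\Gamma(K\,\mathrm{End}_-(H))$, and $A|_L=A_L$. -/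

import Mathlib

open scoped Quaternion Manifold ContDiff

/-- The quaternionic plane `ℍ²`. It is a right quaternionic vector space: `ℍᵐᵒᵖ` acts on it by
coordinatewise multiplication from the right. -/
abbrev H2 : Type := Fin 2 → ℍ[ℝ]

/-- The field `ℂ`, seen as the subfield of `ℍ` generated by `1` and `i`, acting on `ℍ²` by
multiplication from the right. This makes `ℍ²` into `ℂ⁴`. -/
def RightComplex : Type := ℂ

namespace RightComplex

noncomputable instance : Field RightComplex := inferInstanceAs (Field ℂ)

noncomputable instance : Algebra ℝ RightComplex := inferInstanceAs (Algebra ℝ ℂ)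

/-- The inclusion `ℂ → ℍ`, `x + i y ↦ x + i y`. -/
noncomputable def toQuaternion : RightComplex →ₐ[ℝ] ℍ[ℝ] := Quaternion.ofComplex

/-- The imaginary unit. -/
noncomputable def I : RightComplex := Complex.I

noncomputable instance : Module RightComplex H2 where
  smul z v := fun k => v k * toQuaternion z
  one_smul v := by funext k; change v k * toQuaternion 1 = _; simp
  mul_smul z w v := by
    funext k; change v k * toQuaternion (z * w) = v k * toQuaternion w * toQuaternion z
    rw [mul_comm, map_mul, mul_assoc]
  smul_zero z := by funext k; change (0 : ℍ[ℝ]) * _ = 0; simp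
  smul_add z v w := by funext k; exact add_mul (v k) (w k) (toQuaternion z)
  add_smul z w v := by
    funext k; change v k * toQuaternion (z + w) = v k * _ + v k * _; rw [map_add, mul_add]
  zero_smul v := by funext k; change v k * toQuaternion 0 = 0; simp

theorem smul_apply (z : RightComplex) (v : H2) (k : Fin 2) :
    (z • v) k = v k * toQuaternion z := rfl

theorem smul_eq_op_smul (z : RightComplex) (v : H2) :
    z • v = MulOpposite.op (toQuaternion z) • v := rfl

instance : IsScalarTower ℝ RightComplex H2 := ⟨fun r z v => by
  funext k; rw [Pi.smul_apply, smul_apply, smul_apply, map_smul, mul_smul_comm]⟩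

instance : SMulCommClass RightComplex ℝ H2 := ⟨fun z r v => by
  funext k; simp [smul_apply]⟩

theorem I_mul_I : I * I = -1 := Complex.I_mul_I

end RightComplex

/-- `R` acts on `ℍ²` from the right through quaternions. The two cases are `R = ℍᵐᵒᵖ` and
`R = RightComplex`. -/
class ActsFromRight (R : Type) [Ring R] [Algebra ℝ R] [Module R H2] : Prop where
  exists_toQuaternion : ∃ ι : R →ₗ[ℝ] ℍ[ℝ], ∀ (c : R) (v : H2) (k : Fin 2), (c • v) k = v k * ι c

instance : ActsFromRight RightComplex :=
  ⟨RightComplex.toQuaternion.toLinearMap, fun _ _ _ => rfl⟩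

instance : ActsFromRight ℍ[ℝ]ᵐᵒᵖ :=
  ⟨(MulOpposite.opLinearEquiv ℝ).symm.toLinearMap, fun _ _ _ => rfl⟩

section Surface

variable {M : Type*} [TopologicalSpace M] [ChartedSpace ℂ M]

/-- The real tangent space of a Riemann surface `M` at `p`. -/
abbrev TSpace (p : M) : Type := TangentSpace 𝓘(ℝ, ℂ) p

/-- The complex structure of the tangent space: multiplication by `i`. -/
noncomputable def rot (p : M) : TSpace p →ₗ[ℝ] TSpace p :=
  (LinearMap.mulLeft ℝ Complex.I : ℂ →ₗ[ℝ] ℂ)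

/-- The differential at `p` of a map from `M` to a real normed space. -/
noncomputable def diff {F : Type*} [NormedAddCommGroup F] [NormedSpace ℝ F] (f : M → F) (p : M) :
    TSpace p →ₗ[ℝ] F :=
  (mfderiv 𝓘(ℝ, ℂ) 𝓘(ℝ, F) f p : TSpace p →L[ℝ] F).toLinearMap

/-- The coordinate vector field in the constant direction `w` of the chart around `p₀`,
a vector field on the domain of that chart. -/
noncomputable def coordField (p₀ : M) (w : ℂ) (q : M) : TSpace q :=
  (mfderiv 𝓘(ℝ, ℂ) 𝓘(ℝ, ℂ) (chartAt ℂ p₀).symm (chartAt ℂ p₀ q) : ℂ → ℂ) w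

/-- Smoothness on `U` of a 1-form on `M` with values in a normed space: its components in all
charts are smooth. -/
def SmoothFormOn {F : Type*} [NormedAddCommGroup F] [NormedSpace ℝ F] (U : Set M)
    (η : ∀ p : M, TSpace p →ₗ[ℝ] F) : Prop :=
  ∀ (p₀ : M) (w : ℂ), ContMDiffOn 𝓘(ℝ, ℂ) 𝓘(ℝ, F) ∞ (fun q => η q (coordField p₀ w q))
    (U ∩ (chartAt ℂ p₀).source)

end Surface

/-- A smooth `R`-line subbundle of the product bundle `M × ℍ²`: a family of `R`-subspaces
that is spanned, locally, by a smooth section without zeros. -/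
structure LineSubbundle (R : Type) [Ring R] [Module R H2]
    (M : Type*) [TopologicalSpace M] [ChartedSpace ℂ M] where
  fiber : M → Submodule R H2
  exists_frame : ∀ p : M, ∃ U : Set M, IsOpen U ∧ p ∈ U ∧ ∃ σ : ∀ q, fiber q,
    ContMDiffOn 𝓘(ℝ, ℂ) 𝓘(ℝ, H2) ∞ (fun q => (σ q : H2)) U ∧
      ∀ q ∈ U, (σ q : H2) ≠ 0 ∧ fiber q = Submodule.span R {(σ q : H2)}

namespace LineSubbundle

variable {M : Type*} [TopologicalSpace M] [ChartedSpace ℂ M]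

/-- `φ` is a smooth section of `E` over the open set `U`; its values off `U` are irrelevant. -/
def SmoothSectionOn {R : Type} [Ring R] [Module R H2] (E : LineSubbundle R M) (U : Set M)
    (φ : ∀ q, E.fiber q) : Prop :=
  ContMDiffOn 𝓘(ℝ, ℂ) 𝓘(ℝ, H2) ∞ (fun q => (φ q : H2)) U

theorem mdifferentiableAt_of_section {R : Type} [Ring R] [Module R H2]
    {E : LineSubbundle R M} {U : Set M} (hU : IsOpen U)
    {φ : ∀ q, E.fiber q} (hφ : E.SmoothSectionOn U φ) {p : M} (hp : p ∈ U) :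
    MDifferentiableAt 𝓘(ℝ, ℂ) 𝓘(ℝ, H2) (fun q => (φ q : H2)) p :=
  (hφ.contMDiffAt (hU.mem_nhds hp)).mdifferentiableAt (by simp)

section Delta

variable {R : Type} [Ring R] [Algebra ℝ R] [Module R H2]

theorem exists_coord_ne_zero {v : H2} (hv : v ≠ 0) : ∃ k, v k ≠ 0 := by
  by_contra! h
  exact hv (funext h)

theorem mdifferentiableAt_coord {f : M → H2} {p : M}
    (hf : MDifferentiableAt 𝓘(ℝ, ℂ) 𝓘(ℝ, H2) f p) (k : Fin 2) :
    HasMFDerivAt 𝓘(ℝ, ℂ) 𝓘(ℝ, ℍ[ℝ]) (fun q => f q k) p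
      ((ContinuousLinearMap.proj (R := ℝ) (φ := fun _ : Fin 2 => ℍ[ℝ]) k).comp
        (mfderiv 𝓘(ℝ, ℂ) 𝓘(ℝ, H2) f p : TSpace p →L[ℝ] H2)) := by
  have h1 := (ContinuousLinearMap.proj (R := ℝ) (φ := fun _ : Fin 2 => ℍ[ℝ]) k).hasFDerivAt
    (x := f p)
  exact HasMFDerivAt.comp (I' := 𝓘(ℝ, H2)) p h1.hasMFDerivAt hf.hasMFDerivAt

/-- The differential of a section that vanishes at `p` takes values in the fibre at `p`. -/
theorem diff_mem_of_eq_zero [ActsFromRight R] (E : LineSubbundle R M) {U : Set M} (hU : IsOpen U)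
    {φ : ∀ q, E.fiber q} (hφ : E.SmoothSectionOn U φ) {p : M} (hp : p ∈ U)
    (h0 : (φ p : H2) = 0) (X : TSpace p) :
    diff (fun q => (φ q : H2)) p X ∈ E.fiber p := by
  obtain ⟨ι, hι⟩ := ActsFromRight.exists_toQuaternion (R := R)
  obtain ⟨V, hV, hpV, σ, hσ, hspan⟩ := E.exists_frame p
  obtain ⟨k, hk⟩ := exists_coord_ne_zero (hspan p hpV).1
  have dσ := mdifferentiableAt_of_section (E := E) hV hσ hpV
  have dφ := mdifferentiableAt_of_section hU hφ hp
  have hσk := (mdifferentiableAt_coord dσ k)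
  have hφk := (mdifferentiableAt_coord dφ k)
  set b : M → ℍ[ℝ] := (fun q => ((σ q : H2) k))⁻¹ * (fun q => (φ q : H2) k) with hb
  have db : MDifferentiableAt 𝓘(ℝ, ℂ) 𝓘(ℝ, ℍ[ℝ]) b p :=
    ((hσk.mdifferentiableAt.inv hk).hasMFDerivAt.mul' hφk).mdifferentiableAt
  have hb0 : b p = 0 := by simp [hb, h0]
  have hne : ∀ᶠ q in nhds p, (σ q : H2) k ≠ 0 :=
    hσk.mdifferentiableAt.continuousAt.eventually_ne hk
  have key : ∀ᶠ q in nhds p, ∃ c : R, b q = ι c ∧ ∀ l, (φ q : H2) l = (σ q : H2) l * b q := by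
    filter_upwards [hne, hV.mem_nhds hpV] with q hq hqV
    obtain ⟨c, hc⟩ := Submodule.mem_span_singleton.1 ((hspan q hqV).2.le (φ q).2)
    have hl : ∀ l, (φ q : H2) l = (σ q : H2) l * ι c := fun l => by rw [← hc, hι]
    have hbc : b q = ι c := by
      simp only [hb, Pi.mul_apply, Pi.inv_apply, hl k]
      rw [← mul_assoc, inv_mul_cancel₀ hq, one_mul]
    exact ⟨c, hbc, fun l => by rw [hbc, hl]⟩
  -- the derivative of `b` stays in the range of `ι`
  set b' : TSpace p →L[ℝ] ℍ[ℝ] := mfderiv 𝓘(ℝ, ℂ) 𝓘(ℝ, ℍ[ℝ]) b p with hb'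
  have hrange : b' X ∈ LinearMap.range ι := by
    by_contra hX
    obtain ⟨f, hf, hker⟩ := Submodule.exists_le_ker_of_notMem hX
    apply hf
    have h1 : HasMFDerivAt 𝓘(ℝ, ℂ) 𝓘(ℝ, ℝ) (f.toContinuousLinearMap ∘ b) p
        (f.toContinuousLinearMap.comp b') :=
      HasMFDerivAt.comp (I' := 𝓘(ℝ, ℍ[ℝ])) p
        (f.toContinuousLinearMap.hasFDerivAt (x := b p)).hasMFDerivAt db.hasMFDerivAt
    have h2 : HasMFDerivAt 𝓘(ℝ, ℂ) 𝓘(ℝ, ℝ) (f.toContinuousLinearMap ∘ b) p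
        (0 : TSpace p →L[ℝ] ℝ) :=
      (hasMFDerivAt_const (I := 𝓘(ℝ, ℂ)) (I' := 𝓘(ℝ, ℝ)) (0 : ℝ) p).congr_of_eventuallyEq (by
        filter_upwards [key] with q hq
        obtain ⟨c, hc, _⟩ := hq
        exact (congrArg f hc).trans (hker ⟨c, rfl⟩))
    exact congrArg (fun T : TSpace p →L[ℝ] ℝ => T X) (hasMFDerivAt_unique h1 h2)
  obtain ⟨c, hc⟩ := hrange
  have hfin : diff (fun q => (φ q : H2)) p X = c • (σ p : H2) := by
    funext l
    have h1 := (mdifferentiableAt_coord dσ l).mul' db.hasMFDerivAt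
    have h2 := h1.congr_of_eventuallyEq (f₁ := fun q => (φ q : H2) l)
      (by filter_upwards [key] with q hq; obtain ⟨_, _, h⟩ := hq; exact h l)
    have h3 := hasMFDerivAt_unique (mdifferentiableAt_coord dφ l) h2
    have h4 := congrArg (fun T : TSpace p →L[ℝ] ℍ[ℝ] => T X) h3
    rw [hι, hc]
    refine h4.trans ?_
    change (σ p : H2) l * b' X + _ * b p = _
    rw [hb0, mul_zero, add_zero]
  rw [hfin]
  exact (E.fiber p).smul_mem c (σ p).2

theorem exists_delta [ActsFromRight R] [IsScalarTower ℝ R H2] [SMulCommClass R ℝ H2]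
    (E : LineSubbundle R M) :
    ∃ δ : ∀ p : M, TSpace p →ₗ[ℝ] (E.fiber p →ₗ[R] H2 ⧸ E.fiber p),
      ∀ (U : Set M) (φ : ∀ q, E.fiber q), IsOpen U → E.SmoothSectionOn U φ → ∀ p ∈ U,
        ∀ X : TSpace p,
          δ p X (φ p) = (E.fiber p).mkQ (diff (fun q => (φ q : H2)) p X) := by
  obtain ⟨ι, hι⟩ := ActsFromRight.exists_toQuaternion (R := R)
  have act : ∀ c : R, ∃ T : H2 →L[ℝ] H2, ∀ v, T v = c • v := fun c =>
    ⟨LinearMap.toContinuousLinearMap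
      { toFun := fun v => c • v
        map_add' := smul_add c
        map_smul' := fun r v => smul_comm c r v }, fun v => rfl⟩
  have hsmul : ∀ (c : R) (f : M → H2) (p : M), MDifferentiableAt 𝓘(ℝ, ℂ) 𝓘(ℝ, H2) f p →
      HasMFDerivAt 𝓘(ℝ, ℂ) 𝓘(ℝ, H2) (fun q => c • f q) p
        ((act c).choose.comp (mfderiv 𝓘(ℝ, ℂ) 𝓘(ℝ, H2) f p : TSpace p →L[ℝ] H2)) := by
    intro c f p hf
    have h : (fun q => c • f q) = (act c).choose ∘ f := by
      funext q; exact ((act c).choose_spec (f q)).symm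
    rw [h]
    exact HasMFDerivAt.comp (I' := 𝓘(ℝ, H2)) p
      ((act c).choose.hasFDerivAt (x := f p)).hasMFDerivAt hf.hasMFDerivAt
  have uniq : ∀ (p : M) (U V : Set M) (φ ψ : ∀ q, E.fiber q), IsOpen U → IsOpen V → p ∈ U →
      p ∈ V → E.SmoothSectionOn U φ → E.SmoothSectionOn V ψ → φ p = ψ p → ∀ X : TSpace p,
      (E.fiber p).mkQ (diff (fun q => (φ q : H2)) p X) =
        (E.fiber p).mkQ (diff (fun q => (ψ q : H2)) p X) := by
    intro p U V φ ψ hU hV hpU hpV hφ hψ h X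
    have hs : E.SmoothSectionOn (U ∩ V) (fun q => φ q - ψ q) :=
      (hφ.mono Set.inter_subset_left).sub (hψ.mono Set.inter_subset_right)
    have hd := E.diff_mem_of_eq_zero (hU.inter hV) hs ⟨hpU, hpV⟩ (by simp [h]) X
    have he : diff (fun q => ((φ q - ψ q : E.fiber q) : H2)) p X =
        diff (fun q => (φ q : H2)) p X - diff (fun q => (ψ q : H2)) p X := by
      have := ((mdifferentiableAt_of_section hU hφ hpU).hasMFDerivAt.sub
        (mdifferentiableAt_of_section hV hψ hpV).hasMFDerivAt).mfderiv
      exact congrArg (fun T : TSpace p →L[ℝ] H2 => T X) this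
    rw [he] at hd
    exact (Submodule.Quotient.eq _).2 hd
  have hex : ∀ p (v : E.fiber p), ∃ φ : ∀ q, E.fiber q, ∃ U, IsOpen U ∧ p ∈ U ∧
      E.SmoothSectionOn U φ ∧ φ p = v := by
    intro p v
    obtain ⟨V, hV, hpV, σ, hσ, hspan⟩ := E.exists_frame p
    obtain ⟨c, hc⟩ := Submodule.mem_span_singleton.1 ((hspan p hpV).2.le v.2)
    refine ⟨fun q => c • σ q, V, hV, hpV, ?_, Subtype.ext hc⟩
    have h := (act c).choose.contDiff.contMDiff.comp_contMDiffOn hσ (n := ∞)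
    refine h.congr fun q _ => ?_
    exact ((act c).choose_spec _).symm
  choose φ U hU hpU hφ hv using hex
  refine ⟨fun p =>
    { toFun := fun X =>
        { toFun := fun v => (E.fiber p).mkQ (diff (fun q => (φ p v q : H2)) p X)
          map_add' := fun v w => ?_
          map_smul' := fun c v => ?_ }
      map_add' := fun X Y => ?_
      map_smul' := fun r X => ?_ }, fun V ψ hV hψ p hp X => ?_⟩
  · have hs : E.SmoothSectionOn (U p v ∩ U p w) (fun q => φ p v q + φ p w q) :=
      ((hφ p v).mono Set.inter_subset_left).add ((hφ p w).mono Set.inter_subset_right)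
    rw [uniq p _ _ (φ p (v + w)) _ (hU p _) ((hU p v).inter (hU p w)) (hpU p _)
      ⟨hpU p v, hpU p w⟩ (hφ p _) hs (by simp [hv]) X, ← map_add]
    congr 1
    have := ((mdifferentiableAt_of_section (hU p v) (hφ p v) (hpU p v)).hasMFDerivAt.add
        (mdifferentiableAt_of_section (hU p w) (hφ p w) (hpU p w)).hasMFDerivAt).mfderiv
    exact congrArg (fun T : TSpace p →L[ℝ] H2 => T X) this
  · have hd := mdifferentiableAt_of_section (hU p v) (hφ p v) (hpU p v)
    have hs : E.SmoothSectionOn (U p v) (fun q => c • φ p v q) := by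
      have h := (act c).choose.contDiff.contMDiff.comp_contMDiffOn (hφ p v) (n := ∞)
      refine h.congr fun q _ => ?_
      exact ((act c).choose_spec _).symm
    rw [uniq p _ _ (φ p (c • v)) _ (hU p _) (hU p v) (hpU p _) (hpU p v) (hφ p _) hs
      (by simp [hv]) X, RingHom.id_apply, ← map_smul]
    congr 1
    refine (congrArg (fun T : TSpace p →L[ℝ] H2 => T X) (hsmul c _ p hd).mfderiv).trans ?_
    exact (act c).choose_spec _
  · ext v; simp
  · ext v
    simp only [map_smul, LinearMap.coe_mk, AddHom.coe_mk, LinearMap.smul_apply, RingHom.id_apply]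
    rfl
  · exact uniq p _ _ _ _ (hU p _) hV (hpU p _) hp (hφ p _) hψ (hv p _) X

/-- The derivative `δ_E ∈ Ω¹(Hom(E, H/E))` of a line subbundle `E ⊂ H = M × ℍ²`, i.e. the
form with `δ_E φ = π_E dφ` for all (local) smooth sections `φ` of `E`. -/
noncomputable def delta [ActsFromRight R] [IsScalarTower ℝ R H2] [SMulCommClass R ℝ H2]
    (E : LineSubbundle R M) (p : M) : TSpace p →ₗ[ℝ] (E.fiber p →ₗ[R] H2 ⧸ E.fiber p) :=
  E.exists_delta.choose p

theorem delta_apply [ActsFromRight R] [IsScalarTower ℝ R H2] [SMulCommClass R ℝ H2]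
    (E : LineSubbundle R M) {U : Set M} {φ : ∀ q, E.fiber q} (hU : IsOpen U)
    (hφ : E.SmoothSectionOn U φ) {p : M} (hp : p ∈ U) (X : TSpace p) :
    E.delta p X (φ p) = (E.fiber p).mkQ (diff (fun q => (φ q : H2)) p X) :=
  E.exists_delta.choose_spec U φ hU hφ p hp X

end Delta
end LineSubbundle

/-- A complex quaternionic line subbundle `(L, J)` of `M × ℍ²`: a quaternionic line subbundle
with a smooth quaternionic linear endomorphism `J` of square `-1`. -/
structure ComplexQuaternionicLine (M : Type*) [TopologicalSpace M] [ChartedSpace ℂ M] extends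
    LineSubbundle ℍ[ℝ]ᵐᵒᵖ M where
  J : ∀ p, fiber p →ₗ[ℍ[ℝ]ᵐᵒᵖ] fiber p
  J_sq : ∀ p v, J p (J p v) = -v
  J_smooth : ∀ (U : Set M) (ψ : ∀ q, fiber q), IsOpen U →
    toLineSubbundle.SmoothSectionOn U ψ →
      toLineSubbundle.SmoothSectionOn U (fun q => J q (ψ q))

namespace LineSubbundle

variable {M : Type*} [TopologicalSpace M] [ChartedSpace ℂ M]

/-- The quaternionic line bundle `L = Eℍ = E ⊕ Ej` of a complex line bundle `E`. -/
noncomputable def quaternionicSpan (E : LineSubbundle RightComplex M) : LineSubbundle ℍ[ℝ]ᵐᵒᵖ M where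
  fiber p := Submodule.span ℍ[ℝ]ᵐᵒᵖ (E.fiber p : Set H2)
  exists_frame p := by
    obtain ⟨U, hU, hp, σ, hσ, h⟩ := E.exists_frame p
    refine ⟨U, hU, hp, fun q => ⟨σ q, Submodule.subset_span (σ q).2⟩, hσ, fun q hq =>
      ⟨(h q hq).1, le_antisymm (Submodule.span_le.2 fun v hv => ?_)
        (Submodule.span_le.2 (Set.singleton_subset_iff.2 (Submodule.subset_span (σ q).2)))⟩⟩
    obtain ⟨c, rfl⟩ := Submodule.mem_span_singleton.1 ((h q hq).2.le hv)
    exact Submodule.mem_span_singleton.2 ⟨MulOpposite.op (RightComplex.toQuaternion c), rfl⟩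

theorem mem_quaternionicSpan (E : LineSubbundle RightComplex M) {p : M} (v : E.fiber p) :
    (v : H2) ∈ E.quaternionicSpan.fiber p :=
  Submodule.subset_span v.2

/-- The inclusion `E ⊂ L = Eℍ`. -/
noncomputable def incl (E : LineSubbundle RightComplex M) {p : M} (v : E.fiber p) :
    E.quaternionicSpan.fiber p :=
  ⟨v, E.mem_quaternionicSpan v⟩

/-- Right multiplication by `i` on a complex line extends to a quaternionic linear endomorphism
of the quaternionic line which it spans. -/
theorem exists_extension (E : LineSubbundle RightComplex M) (p : M) :
    ∃ J : E.quaternionicSpan.fiber p →ₗ[ℍ[ℝ]ᵐᵒᵖ] E.quaternionicSpan.fiber p,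
      ∀ v : E.fiber p, J (E.incl v) = E.incl (RightComplex.I • v) := by
  obtain ⟨U, hU, hp, σ, hσ, h⟩ := E.exists_frame p
  obtain ⟨hne, hspan⟩ := h p hp
  have hL : E.quaternionicSpan.fiber p = Submodule.span ℍ[ℝ]ᵐᵒᵖ {(σ p : H2)} := by
    refine le_antisymm (Submodule.span_le.2 fun v hv => ?_)
      (Submodule.span_le.2 (Set.singleton_subset_iff.2 (Submodule.subset_span (σ p).2)))
    obtain ⟨c, rfl⟩ := Submodule.mem_span_singleton.1 (hspan.le hv)
    exact Submodule.mem_span_singleton.2 ⟨MulOpposite.op (RightComplex.toQuaternion c), rfl⟩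
  let e := (LinearEquiv.toSpanNonzeroSingleton ℍ[ℝ]ᵐᵒᵖ H2 (σ p : H2) hne)
  let J := (LinearMap.toSpanSingleton ℍ[ℝ]ᵐᵒᵖ (E.quaternionicSpan.fiber p)
    (E.incl (RightComplex.I • σ p))).comp
      (e.symm.toLinearMap.comp (LinearEquiv.ofEq _ _ hL).toLinearMap)
  refine ⟨J, fun v => ?_⟩
  obtain ⟨c, hc⟩ := Submodule.mem_span_singleton.1 (hspan.le v.2)
  obtain rfl : c • σ p = v := Subtype.ext hc
  have he : LinearEquiv.ofEq _ _ hL (E.incl (c • σ p)) =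
      e (MulOpposite.op (RightComplex.toQuaternion c)) := Subtype.ext rfl
  change LinearMap.toSpanSingleton ℍ[ℝ]ᵐᵒᵖ (E.quaternionicSpan.fiber p)
    (E.incl (RightComplex.I • σ p)) (e.symm (LinearEquiv.ofEq _ _ hL (E.incl (c • σ p)))) = _
  rw [he, LinearEquiv.symm_apply_apply, LinearMap.toSpanSingleton_apply]
  apply Subtype.ext
  change c • (RightComplex.I • (σ p : H2)) = RightComplex.I • (c • (σ p : H2))
  exact smul_comm _ _ _

/-- The extension of `J_E` to `L = Eℍ`; it is right multiplication by `-i` on `Ej`. -/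
noncomputable def twistorJ (E : LineSubbundle RightComplex M) (p : M) :
    E.quaternionicSpan.fiber p →ₗ[ℍ[ℝ]ᵐᵒᵖ] E.quaternionicSpan.fiber p :=
  (E.exists_extension p).choose

theorem twistorJ_incl (E : LineSubbundle RightComplex M) {p : M} (v : E.fiber p) :
    E.twistorJ p (E.incl v) = E.incl (RightComplex.I • v) :=
  (E.exists_extension p).choose_spec v

theorem contMDiffOn_coord {f : M → H2} {U : Set M}
    (hf : ContMDiffOn 𝓘(ℝ, ℂ) 𝓘(ℝ, H2) ∞ f U) (k : Fin 2) :
    ContMDiffOn 𝓘(ℝ, ℂ) 𝓘(ℝ, ℍ[ℝ]) ∞ (fun q => f q k) U :=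
  (contMDiffOn_pi_space.1 hf) k

theorem contMDiffAt_mul_quaternion {f g : M → ℍ[ℝ]} {p : M}
    (hf : ContMDiffAt 𝓘(ℝ, ℂ) 𝓘(ℝ, ℍ[ℝ]) ∞ f p) (hg : ContMDiffAt 𝓘(ℝ, ℂ) 𝓘(ℝ, ℍ[ℝ]) ∞ g p) :
    ContMDiffAt 𝓘(ℝ, ℂ) 𝓘(ℝ, ℍ[ℝ]) ∞ (fun q => f q * g q) p :=
  ContDiffAt.comp_contMDiffAt (g := fun x : ℍ[ℝ] × ℍ[ℝ] => x.1 * x.2) (f := fun q => (f q, g q))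
    contDiff_mul.contDiffAt (hf.prodMk_space hg)

/-- The twistor projection `(L, J)` of a complex line subbundle `E ⊂ M × ℍ² = M × ℂ⁴`. -/
noncomputable def twistorProjection (E : LineSubbundle RightComplex M) :
    ComplexQuaternionicLine M where
  toLineSubbundle := E.quaternionicSpan
  J := E.twistorJ
  J_sq p v := by
    obtain ⟨v, hv⟩ := v
    refine Submodule.span_induction (p := fun v hv => E.twistorJ p (E.twistorJ p ⟨v, hv⟩) =
      -(⟨v, hv⟩ : E.quaternionicSpan.fiber p)) ?_ ?_ ?_ ?_ hv
    · intro x hx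
      have h := E.twistorJ_incl ⟨x, hx⟩
      change E.twistorJ p (E.twistorJ p (E.incl ⟨x, hx⟩)) = _
      rw [h, E.twistorJ_incl, smul_smul, RightComplex.I_mul_I]
      apply Subtype.ext
      change ((-1 : RightComplex) • x) = -x
      simp
    · exact (by simp : E.twistorJ p (E.twistorJ p 0) = -0)
    · intro x y hx hy h1 h2
      have : (⟨x + y, add_mem hx hy⟩ : E.quaternionicSpan.fiber p) = ⟨x, hx⟩ + ⟨y, hy⟩ := rfl
      rw [this, map_add, map_add, h1, h2, neg_add]
    · intro c x hx h1
      have : (⟨c • x, Submodule.smul_mem _ c hx⟩ : E.quaternionicSpan.fiber p) = c • ⟨x, hx⟩ := rfl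
      rw [this, map_smul, map_smul, h1, smul_neg]
  J_smooth U ψ hU hψ := by
    intro p hp
    obtain ⟨V, hV, hpV, σ, hσ, h⟩ := E.exists_frame p
    obtain ⟨k, hk⟩ := exists_coord_ne_zero (h p hpV).1
    have hσp : ∀ l, ContMDiffAt 𝓘(ℝ, ℂ) 𝓘(ℝ, ℍ[ℝ]) ∞ (fun q => (σ q : H2) l) p := fun l =>
      (contMDiffOn_coord hσ l).contMDiffAt (hV.mem_nhds hpV)
    have hψp : ContMDiffAt 𝓘(ℝ, ℂ) 𝓘(ℝ, ℍ[ℝ]) ∞ (fun q => (ψ q : H2) k) p :=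
      (contMDiffOn_coord hψ k).contMDiffAt (hU.mem_nhds hp)
    have hinv : ContDiffAt ℝ ∞ (fun x : ℍ[ℝ] => x⁻¹) ((σ p : H2) k) := by
      have := contDiffAt_ringInverse ℝ (n := ∞) (Units.mk0 _ hk)
      simpa [Ring.inverse_eq_inv'] using this
    have hb : ContMDiffAt 𝓘(ℝ, ℂ) 𝓘(ℝ, ℍ[ℝ]) ∞ (fun q => ((σ q : H2) k)⁻¹ * (ψ q : H2) k) p :=
      contMDiffAt_mul_quaternion (ContDiffAt.comp_contMDiffAt (g := fun x : ℍ[ℝ] => x⁻¹)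
        (f := fun q => (σ q : H2) k) hinv (hσp k)) hψp
    refine ContMDiffAt.contMDiffWithinAt ?_
    have hJ : ContMDiffAt 𝓘(ℝ, ℂ) 𝓘(ℝ, H2) ∞ (fun q => fun l => (σ q : H2) l *
        RightComplex.toQuaternion RightComplex.I * (((σ q : H2) k)⁻¹ * (ψ q : H2) k)) p :=
      contMDiffAt_pi_space.2 fun l =>
        contMDiffAt_mul_quaternion (contMDiffAt_mul_quaternion (hσp l) contMDiffAt_const) hb
    refine hJ.congr_of_eventuallyEq ?_
    filter_upwards [hV.mem_nhds hpV, (hσp k).continuousAt.eventually_ne hk] with q hq hqk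
    have hm : (ψ q : H2) ∈ Submodule.span ℍ[ℝ]ᵐᵒᵖ {(σ q : H2)} := by
      refine (Submodule.span_le.2 fun v hv => ?_ :
        E.quaternionicSpan.fiber q ≤ Submodule.span ℍ[ℝ]ᵐᵒᵖ {(σ q : H2)}) (ψ q).2
      obtain ⟨c, rfl⟩ := Submodule.mem_span_singleton.1 ((h q hq).2.le hv)
      exact Submodule.mem_span_singleton.2 ⟨MulOpposite.op (RightComplex.toQuaternion c), rfl⟩
    obtain ⟨c, hc⟩ := Submodule.mem_span_singleton.1 hm
    have hψq : ψ q = c • E.incl (σ q) := Subtype.ext hc.symm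
    rw [hψq, map_smul, E.twistorJ_incl]
    funext l
    change (σ q : H2) l * RightComplex.toQuaternion RightComplex.I * c.unop =
      (σ q : H2) l * RightComplex.toQuaternion RightComplex.I *
        (((σ q : H2) k)⁻¹ * ((σ q : H2) k * c.unop))
    rw [← mul_assoc (((σ q : H2) k)⁻¹), inv_mul_cancel₀ hqk, one_mul]

/-- `E` is a holomorphic curve in `ℂP³`: `*δ_E = δ_E J_E`, where `*` is precomposition with the
complex structure of the tangent spaces and `J_E` is multiplication by `i`. -/
def IsHolomorphicCurve (E : LineSubbundle RightComplex M) : Prop :=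
  ∀ (p : M) (X : TSpace p) (v : E.fiber p),
    E.delta p (rot p X) v = E.delta p X (RightComplex.I • v)

/-- The form `½ (δ_E + *δ_E J_E) ∈ Ω¹(Hom(E, H/E))`. -/
noncomputable def halfDelta (E : LineSubbundle RightComplex M) (p : M) :
    TSpace p →ₗ[ℝ] (E.fiber p →ₗ[RightComplex] H2 ⧸ E.fiber p) where
  toFun X := (1 / 2 : ℝ) • (E.delta p X +
    (E.delta p (rot p X)).comp (RightComplex.I • LinearMap.id))
  map_add' X Y := by
    simp only [map_add, LinearMap.add_comp, smul_add]; abel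
  map_smul' r X := by
    ext v
    simp only [map_smul, LinearMap.smul_apply, LinearMap.add_apply, LinearMap.comp_apply,
      RingHom.id_apply, smul_add, smul_comm r (1 / 2 : ℝ),
      smul_comm RightComplex.I r]

/-- A quaternionic line subbundle of `M × ℍ²` is immersed: its derivative is injective. -/
def IsImmersed (L : LineSubbundle ℍ[ℝ]ᵐᵒᵖ M) : Prop :=
  ∀ (p : M) (X : TSpace p), L.delta p X = 0 → X = 0

end LineSubbundle

namespace ComplexQuaternionicLine

variable {M : Type*} [TopologicalSpace M] [ChartedSpace ℂ M]

/-- `(L, J)` is a holomorphic curve in `ℍP¹`: `*δ_L = δ_L J`. -/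
def IsHolomorphicCurve (L : ComplexQuaternionicLine M) : Prop :=
  ∀ (p : M) (X : TSpace p) (v : L.fiber p),
    L.delta p (rot p X) v = L.delta p X (L.J p v)

/-- The operator `D̃ψ = ½ (dψ + *d(Jψ))` on sections of `L`. Its values are, a priori, forms
with values in `ℍ²`. -/
noncomputable def dTilde (L : ComplexQuaternionicLine M) (ψ : ∀ q, L.fiber q) (p : M) :
    TSpace p →ₗ[ℝ] H2 :=
  (1 / 2 : ℝ) • (diff (fun q => (ψ q : H2)) p +
    (diff (fun q => (L.J q (ψ q) : H2)) p).comp (rot p))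

/-- 1-forms on `M` with values in `End(L)` (no smoothness required). -/
abbrev EndForm (L : ComplexQuaternionicLine M) : Type _ :=
  ∀ p : M, TSpace p →ₗ[ℝ] (L.fiber p →ₗ[ℍ[ℝ]ᵐᵒᵖ] L.fiber p)

/-- The form `A` is `A_L = ½ (D̃ + J D̃ J)`, as operators on (local) smooth sections of `L`.
This includes that `D̃ J ψ` has values in `L`, so that `J` can be applied to it. -/
def IsAL (L : ComplexQuaternionicLine M) (A : L.EndForm) : Prop :=
  ∀ (U : Set M) (ψ : ∀ q, L.fiber q), IsOpen U → L.SmoothSectionOn U ψ →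
    ∀ p ∈ U, ∀ X : TSpace p, ∃ h : L.dTilde (fun q => L.J q (ψ q)) p X ∈ L.fiber p,
      (A p X (ψ p) : H2) = (1 / 2 : ℝ) • (L.dTilde ψ p X + (L.J p ⟨_, h⟩ : H2))

/-- The form `A` is the `(1,0)`-part `½ (D̃ - J *D̃)` of `D̃`. -/
def IsOneZeroPart (L : ComplexQuaternionicLine M) (A : L.EndForm) : Prop :=
  ∀ (U : Set M) (ψ : ∀ q, L.fiber q), IsOpen U → L.SmoothSectionOn U ψ →
    ∀ p ∈ U, ∀ X : TSpace p, ∃ h : L.dTilde ψ p (rot p X) ∈ L.fiber p,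
      (A p X (ψ p) : H2) = (1 / 2 : ℝ) • (L.dTilde ψ p X - (L.J p ⟨_, h⟩ : H2))

/-- `A ∈ Γ(K End₋(L))`: the form `A` is smooth, `*A = J A`, and `A J = - J A`. -/
structure IsKEndMinus (L : ComplexQuaternionicLine M) (A : L.EndForm) : Prop where
  smooth : ∀ (U : Set M) (ψ : ∀ q, L.fiber q), IsOpen U → L.SmoothSectionOn U ψ →
    SmoothFormOn U (fun q =>
      { toFun := fun X => (A q X (ψ q) : H2)
        map_add' := fun X Y => by simp
        map_smul' := fun r X => by rw [map_smul]; rfl })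
  type_K : ∀ (p : M) (X : TSpace p) (v : L.fiber p), A p (rot p X) v = L.J p (A p X v)
  anti : ∀ (p : M) (X : TSpace p) (v : L.fiber p), A p X (L.J p v) = -L.J p (A p X v)

end ComplexQuaternionicLine

section MeanCurvatureSphere

variable {M : Type*} [TopologicalSpace M] [ChartedSpace ℂ M]

/-- A complex structure `S` on the quaternionic bundle `M × ℍ²`: a smooth map from `M` into the
quaternionic linear endomorphisms of `ℍ²`, with `S² = -1`. Quaternionic linear endomorphisms
are regarded as elements of the real vector space of all real linear endomorphisms. -/
structure IsComplexStructure (S : M → (H2 →L[ℝ] H2)) : Prop where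
  smooth : ContMDiff 𝓘(ℝ, ℂ) 𝓘(ℝ, H2 →L[ℝ] H2) ∞ S
  linear : ∀ (p : M) (c : ℍ[ℝ]ᵐᵒᵖ) (v : H2), S p (c • v) = c • S p v
  sq : ∀ (p : M) (v : H2), S p (S p v) = -v

/-- The Hopf field `A = ¼ (S dS + *dS)`. -/
noncomputable def hopfA (S : M → (H2 →L[ℝ] H2)) (p : M) : TSpace p →ₗ[ℝ] (H2 →L[ℝ] H2) where
  toFun X := (1 / 4 : ℝ) • ((S p).comp (diff S p X) + diff S p (rot p X))
  map_add' X Y := by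
    simp only [map_add, ContinuousLinearMap.comp_add, smul_add]; abel
  map_smul' r X := by
    simp only [map_smul, ContinuousLinearMap.comp_smul, smul_add, RingHom.id_apply,
      smul_comm r (1 / 4 : ℝ)]

/-- The Hopf field `Q = ¼ (S dS - *dS)`. -/
noncomputable def hopfQ (S : M → (H2 →L[ℝ] H2)) (p : M) (X : TSpace p) : H2 →L[ℝ] H2 :=
  (1 / 4 : ℝ) • ((S p).comp (diff S p X) - diff S p (rot p X))

/-- `S` is the mean curvature sphere congruence of the quaternionic line subbundle `L`: a complex
structure on `M × ℍ²` with `SL = L`, `dS L ⊂ L`, `*δ = δ ∘ S = S ∘ δ` and `Q|_L = 0`. -/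
structure IsMeanCurvatureSphere (L : LineSubbundle ℍ[ℝ]ᵐᵒᵖ M) (S : M → (H2 →L[ℝ] H2)) : Prop
    extends IsComplexStructure S where
  image_eq : ∀ p, S p '' (L.fiber p : Set H2) = L.fiber p
  dS_mem : ∀ (p : M) (X : TSpace p), ∀ v ∈ L.fiber p, diff S p X v ∈ L.fiber p
  star_delta_eq_delta_S : ∀ (p : M) (X : TSpace p) (v w : L.fiber p), (w : H2) = S p v →
    L.delta p (rot p X) v = L.delta p X w
  star_delta_eq_S_delta : ∀ (p : M) (X : TSpace p) (v : L.fiber p) (u : H2),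
    (L.fiber p).mkQ u = L.delta p X v → L.delta p (rot p X) v = (L.fiber p).mkQ (S p u)
  Q_eq_zero : ∀ (p : M) (X : TSpace p), ∀ v ∈ L.fiber p, hopfQ S p X v = 0

/-- `A ∈ Γ(K End₋(H))` for `H = M × ℍ²` with complex structure `S`: the form `A` is smooth with
values in the quaternionic linear endomorphisms, `*A = S A`, and `A S = - S A`. -/
structure IsKEndMinusH (S : M → (H2 →L[ℝ] H2)) (A : ∀ p : M, TSpace p →ₗ[ℝ] (H2 →L[ℝ] H2)) :
    Prop where
  smooth : SmoothFormOn (F := H2 →L[ℝ] H2) Set.univ A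
  linear : ∀ (p : M) (X : TSpace p) (c : ℍ[ℝ]ᵐᵒᵖ) (v : H2), A p X (c • v) = c • A p X v
  type_K : ∀ (p : M) (X : TSpace p), A p (rot p X) = (S p).comp (A p X)
  anti : ∀ (p : M) (X : TSpace p), (A p X).comp (S p) = -(S p).comp (A p X)

end MeanCurvatureSphere

/-!
The differential of the action of `J` on sections `ψ` of `L` satisfies `d(Jψ) = J dψ` at the zeros
of `ψ`, where `dψ` has values in `L`. Hence `D̃ψ = ½ (dψ + *d(Jψ))` is `½ (dψ + J *dψ)` there, and
this is killed by the projection `½ (1 - J *)` onto the `(1,0)`-part: the `(1,0)`-part of `D̃` is of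
order zero, i.e. a form `A_L` with values in `End(L)`. That `D̃` has values in `L` at all is the
equation `δ_L + *δ_L J = 0`, which is the holomorphicity of `(L, J)`.

On sections `φ` of `E` the form `½ (δ_E + *δ_E J_E)` is `π_E D̃φ`, and `D̃φ - A_L φ` is the image
of `D̃φ` under the projection `½ (1 - R_i J)` of `L` onto `E`, where `R_i` is the right
multiplication by `i`; so `½ (δ_E + *δ_E J_E) = π_E A_L` on `E`. If this vanishes, then `A_L` maps
the `i`-eigenspace `E` of `J` into itself, but also into the `(-i)`-eigenspace since
`A_L J = -J A_L`; so `A_L = 0`. The bundle `E` is recovered from `(L, J)` as the `i`-eigenbundle of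
`J`.

Finally, `A S = -S A` for `A = ¼ (S dS + *dS)` is the derivative of `S² = -1`, and `A = A_L` on `L`
is the Leibniz rule `d(Sψ) = S dψ + dS ψ`.
-/

section Differential

variable {M : Type*} [TopologicalSpace M] [ChartedSpace ℂ M]
  {F F' G : Type*} [NormedAddCommGroup F] [NormedSpace ℝ F] [NormedAddCommGroup F']
  [NormedSpace ℝ F'] [NormedAddCommGroup G] [NormedSpace ℝ G]

theorem contMDiffOn_const_smul (r : ℝ) {f : M → F} {U : Set M}
    (hf : ContMDiffOn 𝓘(ℝ, ℂ) 𝓘(ℝ, F) ∞ f U) :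
    ContMDiffOn 𝓘(ℝ, ℂ) 𝓘(ℝ, F) ∞ (fun q => r • f q) U :=
  (contDiff_const_smul r).contMDiff.comp_contMDiffOn hf

theorem diff_congr {f g : M → F} {p : M} (h : f =ᶠ[nhds p] g) : diff f p = diff g p :=
  congrArg (fun T : TSpace p →L[ℝ] F => T.toLinearMap) h.mfderiv_eq

theorem diff_apply_of_hasMFDerivAt {f : M → F} {p : M} {f' : TSpace p →L[ℝ] F}
    (h : HasMFDerivAt 𝓘(ℝ, ℂ) 𝓘(ℝ, F) f p f') (X : TSpace p) : diff f p X = f' X :=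
  congrArg (fun T : TSpace p →L[ℝ] F => T X) h.mfderiv

theorem diff_add {f g : M → F} {p : M} (hf : MDifferentiableAt 𝓘(ℝ, ℂ) 𝓘(ℝ, F) f p)
    (hg : MDifferentiableAt 𝓘(ℝ, ℂ) 𝓘(ℝ, F) g p) (X : TSpace p) :
    diff (fun q => f q + g q) p X = diff f p X + diff g p X :=
  diff_apply_of_hasMFDerivAt (hf.hasMFDerivAt.add hg.hasMFDerivAt) X

theorem diff_clm_comp (T : F →L[ℝ] G) {f : M → F} {p : M}
    (hf : MDifferentiableAt 𝓘(ℝ, ℂ) 𝓘(ℝ, F) f p) (X : TSpace p) :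
    diff (fun q => T (f q)) p X = T (diff f p X) :=
  mfderiv_comp_apply (I' := 𝓘(ℝ, F)) p T.differentiableAt.mdifferentiableAt hf X |>.trans
    (by rw [mfderiv_eq_fderiv, T.fderiv]; rfl)

theorem diff_clm_apply₂ (B : F →L[ℝ] G →L[ℝ] F') {f : M → F} {g : M → G} {p : M}
    (hf : MDifferentiableAt 𝓘(ℝ, ℂ) 𝓘(ℝ, F) f p) (hg : MDifferentiableAt 𝓘(ℝ, ℂ) 𝓘(ℝ, G) g p)
    (X : TSpace p) :
    diff (fun q => B (f q) (g q)) p X = B (f p) (diff g p X) + B (diff f p X) (g p) := by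
  have hB := (B.isBoundedBilinearMap.hasFDerivAt (f p, g p)).hasMFDerivAt
  have hfg : HasMFDerivAt 𝓘(ℝ, ℂ) 𝓘(ℝ, F × G) (fun q => (f q, g q)) p
      ((mfderiv 𝓘(ℝ, ℂ) 𝓘(ℝ, F) f p : TSpace p →L[ℝ] F).prod
        (mfderiv 𝓘(ℝ, ℂ) 𝓘(ℝ, G) g p : TSpace p →L[ℝ] G)) :=
    ⟨hf.continuousAt.prodMk hg.continuousAt, hf.hasMFDerivAt.2.prodMk hg.hasMFDerivAt.2⟩
  exact diff_apply_of_hasMFDerivAt (HasMFDerivAt.comp (I' := 𝓘(ℝ, F × G)) p hB hfg) X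

theorem rot_rot (p : M) (X : TSpace p) : rot p (rot p X) = -X := by
  have I_mul_I_mul (z : ℂ) : Complex.I * (Complex.I * z) = -z := by
    rw [← mul_assoc, Complex.I_mul_I, neg_one_mul]
  exact I_mul_I_mul X

theorem isManifold_real {n : ℕ∞ω} [IsManifold 𝓘(ℂ) n M] : IsManifold 𝓘(ℝ, ℂ) n M :=
  isManifold_of_contDiffOn _ _ _ fun _ _ he he' =>
    ((contDiffGroupoid n 𝓘(ℂ)).compatible he he').1.restrict_scalars ℝ

theorem hasMFDerivAt_restrictScalars {N : Type*} [TopologicalSpace N] [ChartedSpace ℂ N]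
    {f : M → N} {p : M} {f' : TangentSpace 𝓘(ℂ) p →L[ℂ] TangentSpace 𝓘(ℂ) (f p)}
    (h : HasMFDerivAt 𝓘(ℂ) 𝓘(ℂ) f p f') :
    HasMFDerivAt 𝓘(ℝ, ℂ) 𝓘(ℝ, ℂ) f p ((f' : ℂ →L[ℂ] ℂ).restrictScalars ℝ) :=
  ⟨h.1, HasFDerivWithinAt.restrictScalars ℝ h.2⟩

theorem rot_coordField [IsManifold 𝓘(ℂ) 1 M] (p₀ : M) (w : ℂ) {q : M}
    (hq : q ∈ (chartAt ℂ p₀).source) :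
    rot q (coordField p₀ w q) = coordField p₀ (Complex.I * w) q := by
  obtain ⟨T, hT⟩ : ∃ T : ℂ →L[ℂ] ℂ, ∀ v, coordField p₀ v q = T v := by
    have hd := mdifferentiableAt_atlas_symm (I := 𝓘(ℂ)) (chart_mem_atlas ℂ p₀)
      ((chartAt ℂ p₀).map_source hq)
    exact ⟨_, fun v => congrArg (fun T : ℂ →L[ℝ] ℂ => T v)
      (hasMFDerivAt_restrictScalars hd.hasMFDerivAt).mfderiv⟩
  rw [hT, hT]
  exact (T.map_smul Complex.I w).symm

theorem diff_coordField [IsManifold 𝓘(ℝ, ℂ) 1 M] {f : M → F} {q : M}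
    (hf : MDifferentiableAt 𝓘(ℝ, ℂ) 𝓘(ℝ, F) f q) {p₀ : M} (hq : q ∈ (chartAt ℂ p₀).source)
    (w : ℂ) :
    diff f q (coordField p₀ w q) =
      fderiv ℝ (f ∘ (chartAt ℂ p₀).symm) (chartAt ℂ p₀ q) w := by
  have hd := mdifferentiableAt_atlas_symm (I := 𝓘(ℝ, ℂ)) (chart_mem_atlas ℂ p₀)
    ((chartAt ℂ p₀).map_source hq)
  rw [← mfderiv_eq_fderiv]
  exact (mfderiv_comp_apply_of_eq _ hf hd ((chartAt ℂ p₀).left_inv hq) w).symm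

theorem smoothFormOn_diff [IsManifold 𝓘(ℝ, ℂ) ∞ M] {f : M → F} {U : Set M}
    (hU : IsOpen U) (hf : ContMDiffOn 𝓘(ℝ, ℂ) 𝓘(ℝ, F) ∞ f U) : SmoothFormOn U (diff f) := by
  intro p₀ w
  set e := chartAt ℂ p₀
  have hf_chart : ContDiffOn ℝ ∞ (f ∘ e.symm) (e.target ∩ e.symm ⁻¹' U) :=
    (hf.comp ((contMDiffOn_chart_symm (I := 𝓘(ℝ, ℂ)) (x := p₀)).mono Set.inter_subset_left)
      Set.inter_subset_right).contDiffOn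
  have hderiv : ContDiffOn ℝ ∞ (fun y => fderiv ℝ (f ∘ e.symm) y w) (e.target ∩ e.symm ⁻¹' U) :=
    (hf_chart.fderiv_of_isOpen (e.symm.isOpen_inter_preimage hU) (by simp)).clm_apply
      contDiffOn_const
  have hmaps : Set.MapsTo e (U ∩ e.source) (e.target ∩ e.symm ⁻¹' U) := fun q hq =>
    ⟨e.map_source hq.2, by simpa only [Set.mem_preimage, e.left_inv hq.2] using hq.1⟩
  refine (hderiv.contMDiffOn.comp ((contMDiffOn_chart (I := 𝓘(ℝ, ℂ)) (x := p₀)).mono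
    Set.inter_subset_right) hmaps).congr fun q hq => ?_
  exact diff_coordField ((hf.contMDiffAt (hU.mem_nhds hq.1)).mdifferentiableAt (by simp)) hq.2 w

theorem smoothFormOn_comp_rot [IsManifold 𝓘(ℂ) 1 M] {U : Set M} {η : ∀ p : M, TSpace p →ₗ[ℝ] F}
    (hη : SmoothFormOn U η) : SmoothFormOn U fun p => (η p).comp (rot p) := fun p₀ w =>
  (hη p₀ (Complex.I * w)).congr fun q hq => congrArg (η q) (rot_coordField p₀ w hq.2)

end Differential

/-- The right multiplication `(b, v) ↦ v b` of `ℍ²` by quaternions, as a real bilinear map: it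
brings the Leibniz rule for `σ b` under that for continuous bilinear maps. -/
noncomputable def rightMul : ℍ[ℝ] →L[ℝ] H2 →L[ℝ] H2 :=
  LinearMap.toContinuousLinearMap <| LinearMap.toContinuousLinearMap.toLinearMap ∘ₗ
    LinearMap.mk₂ ℝ (fun (b : ℍ[ℝ]) (v : H2) => MulOpposite.op b • v)
      (fun b c v => by rw [MulOpposite.op_add, add_smul])
      (fun r b v => by rw [MulOpposite.op_smul, smul_assoc])
      (fun b v w => smul_add _ v w) (fun r b v => smul_comm _ r v)

theorem rightMul_apply (b : ℍ[ℝ]) (v : H2) : rightMul b v = MulOpposite.op b • v := rfl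

/-- Multiplication by a scalar of `R`, as a continuous real linear endomorphism of `ℍ²`. -/
noncomputable def smulCLM {R : Type} [Ring R] [Module R H2] [SMulCommClass R ℝ H2] (c : R) :
    H2 →L[ℝ] H2 :=
  LinearMap.toContinuousLinearMap (DistribSMul.toLinearMap ℝ H2 c)

namespace LineSubbundle

variable {M : Type*} [TopologicalSpace M] [ChartedSpace ℂ M]

theorem exists_section_eqOn {R : Type} [Ring R] [Module R H2] (E : LineSubbundle R M) {U : Set M}
    {f : M → H2} (hf : ContMDiffOn 𝓘(ℝ, ℂ) 𝓘(ℝ, H2) ∞ f U) (hmem : ∀ q ∈ U, f q ∈ E.fiber q) :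
    ∃ φ : ∀ q, E.fiber q, E.SmoothSectionOn U φ ∧ ∀ q ∈ U, (φ q : H2) = f q := by
  classical
  let φ (q : M) : E.fiber q := if hq : q ∈ U then ⟨f q, hmem q hq⟩ else 0
  have hφ (q : M) (hq : q ∈ U) : (φ q : H2) = f q := by simp only [φ, dif_pos hq]
  exact ⟨φ, hf.congr hφ, hφ⟩

section LocalSections

variable {R : Type} [Ring R] [Module R H2] [SMulCommClass R ℝ H2] (E : LineSubbundle R M) (p : M)

/-- The module of local sections of `E` at `p`: families of vectors in the fibres that are smooth
near `p`, with irrelevant values elsewhere. -/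
def sectionsNear : Submodule R (∀ q, E.fiber q) where
  carrier := {φ | ∃ U : Set M, IsOpen U ∧ p ∈ U ∧ E.SmoothSectionOn U φ}
  add_mem' := by
    rintro φ ψ ⟨U, hU, hpU, hφ⟩ ⟨V, hV, hpV, hψ⟩
    exact ⟨U ∩ V, hU.inter hV, ⟨hpU, hpV⟩,
      (hφ.mono Set.inter_subset_left).add (hψ.mono Set.inter_subset_right)⟩
  zero_mem' := ⟨Set.univ, isOpen_univ, Set.mem_univ p, contMDiffOn_const⟩
  smul_mem' := by
    rintro c φ ⟨U, hU, hpU, hφ⟩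
    exact ⟨U, hU, hpU, (smulCLM c).contDiff.contMDiff.comp_contMDiffOn (n := ∞) hφ⟩

/-- The value at `p` of a local section at `p`. -/
noncomputable def evalAt : E.sectionsNear p →ₗ[R] E.fiber p :=
  (LinearMap.proj p).comp (E.sectionsNear p).subtype

theorem evalAt_surjective : Function.Surjective (E.evalAt p) := by
  intro v
  obtain ⟨U, hU, hpU, σ, hσ, hspan⟩ := E.exists_frame p
  obtain ⟨c, hc⟩ := Submodule.mem_span_singleton.1 ((hspan p hpU).2.le v.2)
  exact ⟨c • (⟨σ, U, hU, hpU, hσ⟩ : E.sectionsNear p), Subtype.ext hc⟩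

variable {E p}

theorem mdifferentiableAt_of_mem_sectionsNear {φ : ∀ q, E.fiber q} (hφ : φ ∈ E.sectionsNear p) :
    MDifferentiableAt 𝓘(ℝ, ℂ) 𝓘(ℝ, H2) (fun q => (φ q : H2)) p :=
  let ⟨_, hU, hpU, hφU⟩ := hφ
  mdifferentiableAt_of_section hU hφU hpU

variable (E p)

/-- The differential at `p` of the local sections of `E` at `p`, as an `R`-linear map. -/
noncomputable def diffAt : TSpace p →ₗ[ℝ] E.sectionsNear p →ₗ[R] H2 :=
  LinearMap.mk₂' ℝ R (fun X φ => diff (fun q => (φ.1 q : H2)) p X)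
    (fun X Y _ => map_add _ X Y) (fun r X _ => map_smul _ r X)
    (fun X φ ψ => diff_add (mdifferentiableAt_of_mem_sectionsNear φ.2)
      (mdifferentiableAt_of_mem_sectionsNear ψ.2) X)
    (fun c X φ => diff_clm_comp (smulCLM c) (mdifferentiableAt_of_mem_sectionsNear φ.2) X)

theorem diffAt_apply (X : TSpace p) (φ : E.sectionsNear p) :
    E.diffAt p X φ = diff (fun q => (φ.1 q : H2)) p X := rfl

theorem delta_evalAt [Algebra ℝ R] [ActsFromRight R] [IsScalarTower ℝ R H2] (X : TSpace p)
    (φ : E.sectionsNear p) :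
    E.delta p X (E.evalAt p φ) = (E.fiber p).mkQ (E.diffAt p X φ) :=
  let ⟨_, hU, hpU, hφ⟩ := φ.2
  E.delta_apply hU hφ hpU X

theorem diffAt_mem_of_evalAt_eq_zero [Algebra ℝ R] [ActsFromRight R] [IsScalarTower ℝ R H2]
    (X : TSpace p) {φ : E.sectionsNear p} (hφ : E.evalAt p φ = 0) :
    E.diffAt p X φ ∈ E.fiber p := by
  rw [← Submodule.Quotient.mk_eq_zero, ← Submodule.mkQ_apply, ← E.delta_evalAt, hφ, map_zero]

end LocalSections

section DivisionRing

variable {R : Type} [DivisionRing R] [Module R H2] (E : LineSubbundle R M) (p : M)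

theorem exists_mem_fiber_ne_zero : ∃ e ∈ E.fiber p, e ≠ 0 :=
  let ⟨_, _, hpU, σ, _, hspan⟩ := E.exists_frame p
  ⟨σ p, (σ p).2, (hspan p hpU).1⟩

variable {E p}

theorem fiber_eq_span_singleton {e : H2} (he : e ∈ E.fiber p) (he0 : e ≠ 0) :
    E.fiber p = Submodule.span R {e} := by
  obtain ⟨U, -, hpU, σ, -, hspan⟩ := E.exists_frame p
  rw [(hspan p hpU).2] at he ⊢
  obtain ⟨c, rfl⟩ := Submodule.mem_span_singleton.1 he
  have hc : c ≠ 0 := by rintro rfl; exact he0 (zero_smul R _)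
  exact (Submodule.span_singleton_smul_eq hc.isUnit _).symm

end DivisionRing

theorem exists_coefficient {L : LineSubbundle ℍ[ℝ]ᵐᵒᵖ M} {p : M} (ψ : L.sectionsNear p)
    {σ : L.sectionsNear p} (hσ : (σ.1 p : H2) ≠ 0) :
    ∃ b : M → ℍ[ℝ], MDifferentiableAt 𝓘(ℝ, ℂ) 𝓘(ℝ, ℍ[ℝ]) b p ∧
      ∀ᶠ q in nhds p, ψ.1 q = MulOpposite.op (b q) • σ.1 q := by
  obtain ⟨k, hk⟩ := exists_coord_ne_zero hσ
  have hσk := mdifferentiableAt_coord (mdifferentiableAt_of_mem_sectionsNear σ.2) k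
  have hψk := mdifferentiableAt_coord (mdifferentiableAt_of_mem_sectionsNear ψ.2) k
  refine ⟨(fun q => ((σ.1 q : H2) k))⁻¹ * (fun q => (ψ.1 q : H2) k),
    ((hσk.mdifferentiableAt.inv hk).hasMFDerivAt.mul' hψk).mdifferentiableAt, ?_⟩
  filter_upwards [hσk.mdifferentiableAt.continuousAt.eventually_ne hk] with q hq
  have hspan := fiber_eq_span_singleton (σ.1 q).2 (fun h => hq (congrFun h k))
  obtain ⟨c, hc⟩ := Submodule.mem_span_singleton.1 (hspan.le (ψ.1 q).2)
  have hck : (ψ.1 q : H2) k = (σ.1 q : H2) k * c.unop := by rw [← hc]; rfl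
  apply Subtype.ext
  rw [Pi.mul_apply, Pi.inv_apply, hck, inv_mul_cancel_left₀ hq]
  exact hc.symm

end LineSubbundle

namespace ComplexQuaternionicLine

variable {M : Type*} [TopologicalSpace M] [ChartedSpace ℂ M] (L : ComplexQuaternionicLine M)

section DTilde

/-- The action of `J` on local sections of `L` at `p`. -/
noncomputable def JOnSections (p : M) : L.sectionsNear p →ₗ[ℍ[ℝ]ᵐᵒᵖ] L.sectionsNear p :=
  (LinearMap.pi fun q => (L.J q).comp (LinearMap.proj q)).restrict
    fun ψ ⟨U, hU, hpU, hψ⟩ => ⟨U, hU, hpU, L.J_smooth U ψ hU hψ⟩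

variable {p : M}

theorem evalAt_JOnSections (ψ : L.sectionsNear p) :
    L.evalAt p (L.JOnSections p ψ) = L.J p (L.evalAt p ψ) := rfl

theorem JOnSections_JOnSections (ψ : L.sectionsNear p) :
    L.JOnSections p (L.JOnSections p ψ) = -ψ :=
  Subtype.ext (funext fun q => L.J_sq q (ψ.1 q))

theorem diffAt_JOnSections_of_evalAt_eq_zero (X : TSpace p) {ψ : L.sectionsNear p}
    (hψ : L.evalAt p ψ = 0) :
    L.diffAt p X (L.JOnSections p ψ) =
      L.J p ⟨L.diffAt p X ψ, L.diffAt_mem_of_evalAt_eq_zero p X hψ⟩ := by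
  obtain ⟨e, he, he0⟩ := L.exists_mem_fiber_ne_zero p
  obtain ⟨σ, hσ⟩ := L.evalAt_surjective p ⟨e, he⟩
  have hσ0 : (σ.1 p : H2) ≠ 0 := (congrArg Subtype.val hσ).trans_ne he0
  obtain ⟨b, hb, hbψ⟩ := LineSubbundle.exists_coefficient ψ hσ0
  have hbp : b p = 0 := by
    have h := (congrArg Subtype.val hbψ.self_of_nhds).symm.trans (congrArg Subtype.val hψ)
    simpa using (smul_eq_zero.1 h).resolve_right hσ0
  have leibniz (φ τ : L.sectionsNear p)
      (h : ∀ᶠ q in nhds p, φ.1 q = MulOpposite.op (b q) • τ.1 q) :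
      L.diffAt p X φ = MulOpposite.op (diff b p X) • (τ.1 p : H2) := by
    rw [L.diffAt_apply, diff_congr (g := fun q => rightMul (b q) (τ.1 q : H2))
      (h.mono fun q hq => congrArg Subtype.val hq), diff_clm_apply₂ rightMul hb
      (LineSubbundle.mdifferentiableAt_of_mem_sectionsNear τ.2), hbp, map_zero,
      zero_apply, zero_add, rightMul_apply]
  have hdψ : (⟨L.diffAt p X ψ, L.diffAt_mem_of_evalAt_eq_zero p X hψ⟩ : L.fiber p) =
      MulOpposite.op (diff b p X) • σ.1 p := Subtype.ext (leibniz ψ σ hbψ)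
  have hbJψ : ∀ᶠ q in nhds p,
      (L.JOnSections p ψ).1 q = MulOpposite.op (b q) • (L.JOnSections p σ).1 q :=
    hbψ.mono fun q hq => (congrArg (L.J q) hq).trans (map_smul (L.J q) _ _)
  rw [leibniz _ _ hbJψ, hdψ, map_smul]
  rfl

theorem isHolomorphicCurve_iff_delta_rot_J :
    L.IsHolomorphicCurve ↔ ∀ (p : M) (X : TSpace p) (v : L.fiber p),
      L.delta p (rot p X) (L.J p v) = -L.delta p X v := by
  refine forall₂_congr fun p X => ⟨fun h v => ?_, fun h v => ?_⟩
  · rw [h, L.J_sq, map_neg]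
  · have hv := h (L.J p v)
    rwa [L.J_sq, map_neg, neg_inj] at hv

theorem dTilde_apply (ψ : L.sectionsNear p) (X : TSpace p) :
    L.dTilde ψ.1 p X =
      (1 / 2 : ℝ) • (L.diffAt p X ψ + L.diffAt p (rot p X) (L.JOnSections p ψ)) := rfl

theorem mkQ_dTilde (ψ : L.sectionsNear p) (X : TSpace p) :
    (L.fiber p).mkQ (L.dTilde ψ.1 p X) = (1 / 2 : ℝ) •
      (L.delta p X (L.evalAt p ψ) + L.delta p (rot p X) (L.J p (L.evalAt p ψ))) := by
  rw [dTilde_apply, LinearMap.map_smul_of_tower, map_add, ← L.evalAt_JOnSections,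
    L.delta_evalAt, L.delta_evalAt]

theorem dTilde_mem_iff (ψ : L.sectionsNear p) (X : TSpace p) :
    L.dTilde ψ.1 p X ∈ L.fiber p ↔
      L.delta p (rot p X) (L.J p (L.evalAt p ψ)) = -L.delta p X (L.evalAt p ψ) := by
  rw [← Submodule.Quotient.mk_eq_zero, ← Submodule.mkQ_apply, mkQ_dTilde,
    smul_eq_zero_iff_right (by norm_num), add_comm, add_eq_zero_iff_eq_neg]

theorem isHolomorphicCurve_iff_dTilde_mem :
    L.IsHolomorphicCurve ↔ ∀ (p : M) (X : TSpace p) (ψ : L.sectionsNear p),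
      L.dTilde ψ.1 p X ∈ L.fiber p := by
  simp only [isHolomorphicCurve_iff_delta_rot_J, dTilde_mem_iff,
    (L.evalAt_surjective _).forall]

variable {L} (hL : L.IsHolomorphicCurve)

/-- The operator `D̃` at the point `p` on a holomorphic curve, with values in `L`. -/
noncomputable def dTildeAt (p : M) : TSpace p →ₗ[ℝ] L.sectionsNear p →ₗ[ℍ[ℝ]ᵐᵒᵖ] L.fiber p :=
  LinearMap.mk₂' ℝ ℍ[ℝ]ᵐᵒᵖ
    (fun X ψ => ⟨L.dTilde ψ.1 p X, L.isHolomorphicCurve_iff_dTilde_mem.1 hL p X ψ⟩)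
    (fun _ _ _ => Subtype.ext (map_add _ _ _)) (fun _ _ _ => Subtype.ext (map_smul _ _ _))
    (fun X ψ χ => Subtype.ext <| (L.dTilde_apply (ψ + χ) X).trans <| by
      rw [map_add, map_add, map_add, add_add_add_comm, smul_add]; rfl)
    (fun c X ψ => Subtype.ext <| (L.dTilde_apply (c • ψ) X).trans <| by
      rw [map_smul, map_smul, map_smul, ← smul_add, smul_comm]; rfl)

theorem coe_dTildeAt (X : TSpace p) (ψ : L.sectionsNear p) :
    (dTildeAt hL p X ψ : H2) = L.dTilde ψ.1 p X := rfl

theorem dTildeAt_JOnSections (X : TSpace p) (ψ : L.sectionsNear p) :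
    dTildeAt hL p X (L.JOnSections p ψ) = -dTildeAt hL p (rot p X) ψ := by
  have diffAt_neg : L.diffAt p (rot p X) (-ψ) = -L.diffAt p (rot p X) ψ := map_neg _ ψ
  apply Subtype.ext
  simp only [Submodule.coe_neg, coe_dTildeAt, dTilde_apply, JOnSections_JOnSections, rot_rot,
    diffAt_neg, map_neg, LinearMap.neg_apply]
  module

/-- The `(1,0)`-part `½ (D̃ - J *D̃)` of `D̃` at the point `p`, on local sections of `L`. -/
noncomputable def dTildeOneZeroAt (p : M) :
    TSpace p →ₗ[ℝ] L.sectionsNear p →ₗ[ℍ[ℝ]ᵐᵒᵖ] L.fiber p where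
  toFun X := (1 / 2 : ℝ) • (dTildeAt hL p X - (L.J p).comp (dTildeAt hL p (rot p X)))
  map_add' X Y := by
    simp only [map_add, LinearMap.comp_add]
    module
  map_smul' r X := by
    simp only [map_smul, LinearMap.comp_smul, RingHom.id_apply]
    module

theorem dTildeOneZeroAt_apply (X : TSpace p) (ψ : L.sectionsNear p) :
    dTildeOneZeroAt hL p X ψ =
      (1 / 2 : ℝ) • (dTildeAt hL p X ψ - L.J p (dTildeAt hL p (rot p X) ψ)) := rfl

theorem dTildeOneZeroAt_rot (X : TSpace p) (ψ : L.sectionsNear p) :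
    dTildeOneZeroAt hL p (rot p X) ψ = L.J p (dTildeOneZeroAt hL p X ψ) := by
  simp only [dTildeOneZeroAt_apply, rot_rot, map_neg, LinearMap.neg_apply,
    LinearMap.map_smul_of_tower, map_sub, L.J_sq]
  module

theorem dTildeOneZeroAt_JOnSections (X : TSpace p) (ψ : L.sectionsNear p) :
    dTildeOneZeroAt hL p X (L.JOnSections p ψ) = -L.J p (dTildeOneZeroAt hL p X ψ) := by
  simp only [dTildeOneZeroAt_apply, dTildeAt_JOnSections, rot_rot, map_neg, LinearMap.neg_apply,
    LinearMap.map_smul_of_tower, map_sub, L.J_sq]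
  module

theorem dTildeOneZeroAt_eq_zero_of_evalAt_eq_zero (X : TSpace p) {ψ : L.sectionsNear p}
    (hψ : L.evalAt p ψ = 0) : dTildeOneZeroAt hL p X ψ = 0 := by
  let dψ (Y : TSpace p) : L.fiber p :=
    ⟨L.diffAt p Y ψ, L.diffAt_mem_of_evalAt_eq_zero p Y hψ⟩
  have dψ_neg : dψ (-X) = -dψ X :=
    Subtype.ext (LinearMap.congr_fun (map_neg (L.diffAt p) X) ψ)
  have dTilde_eq (Y : TSpace p) :
      dTildeAt hL p Y ψ = (1 / 2 : ℝ) • (dψ Y + L.J p (dψ (rot p Y))) := by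
    apply Subtype.ext
    rw [coe_dTildeAt, dTilde_apply, diffAt_JOnSections_of_evalAt_eq_zero L _ hψ]
    rfl
  rw [dTildeOneZeroAt_apply, dTilde_eq, dTilde_eq, rot_rot, dψ_neg, LinearMap.map_smul_of_tower,
    map_add, L.J_sq]
  module

end DTilde

section HopfField

variable {L}

theorem isAL_iff (hL : L.IsHolomorphicCurve) {A : L.EndForm} :
    L.IsAL A ↔ ∀ (p : M) (X : TSpace p) (ψ : L.sectionsNear p),
      A p X (L.evalAt p ψ) = dTildeOneZeroAt hL p X ψ := by
  have coe_eq (p : M) (X : TSpace p) (ψ : L.sectionsNear p) :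
      (dTildeOneZeroAt hL p X ψ : H2) = (1 / 2 : ℝ) •
        (L.dTilde ψ.1 p X + (L.J p (dTildeAt hL p X (L.JOnSections p ψ)) : H2)) := by
    rw [dTildeAt_JOnSections, map_neg, Submodule.coe_neg, ← sub_eq_add_neg]
    rfl
  refine ⟨fun hA p X ψ => ?_, fun hA U ψ hU hψ p hp X => ?_⟩
  · obtain ⟨U, hU, hpU, hψ⟩ := ψ.2
    obtain ⟨_, h⟩ := hA U ψ.1 hU hψ p hpU X
    exact Subtype.ext (h.trans (coe_eq p X ψ).symm)
  · let ψ' : L.sectionsNear p := ⟨ψ, U, hU, hp, hψ⟩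
    exact ⟨(dTildeAt hL p X (L.JOnSections p ψ')).2,
      (congrArg Subtype.val (hA p X ψ')).trans (coe_eq p X ψ')⟩

theorem existsUnique_isAL (hL : L.IsHolomorphicCurve) : ∃! A : L.EndForm, L.IsAL A := by
  choose g hg using fun p => (L.evalAt p).exists_rightInverse_of_surjective
    (LinearMap.range_eq_top.2 (L.evalAt_surjective p))
  let A : L.EndForm := fun p =>
    { toFun := fun X => (dTildeOneZeroAt hL p X).comp (g p)
      map_add' := fun X Y => by rw [map_add, LinearMap.add_comp]
      map_smul' := fun r X => by rw [map_smul, LinearMap.smul_comp, RingHom.id_apply] }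
  refine ⟨A, (isAL_iff hL).2 fun p X ψ => ?_, fun B hB => ?_⟩
  · rw [← sub_eq_zero]
    refine (map_sub (dTildeOneZeroAt hL p X) _ ψ).symm.trans
      (dTildeOneZeroAt_eq_zero_of_evalAt_eq_zero hL X ?_)
    rw [map_sub, sub_eq_zero]
    exact LinearMap.congr_fun (hg p) (L.evalAt p ψ)
  · funext p
    ext1 X
    ext1 v
    have hgv : L.evalAt p (g p v) = v := LinearMap.congr_fun (hg p) v
    exact (congrArg (B p X) hgv).symm.trans ((isAL_iff hL).1 hB p X (g p v))

namespace IsAL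

variable {A : L.EndForm}

theorem isHolomorphicCurve (hA : L.IsAL A) : L.IsHolomorphicCurve := by
  refine L.isHolomorphicCurve_iff_dTilde_mem.2 fun p X ψ => ?_
  obtain ⟨U, hU, hpU, hJψ⟩ := (-L.JOnSections p ψ).2
  obtain ⟨h, -⟩ := hA U _ hU hJψ p hpU X
  have J_neg_J : L.JOnSections p (-L.JOnSections p ψ) = ψ :=
    (map_neg (L.JOnSections p) _).trans
      ((congrArg (-·) (L.JOnSections_JOnSections ψ)).trans (neg_neg ψ))
  exact (congrArg (fun χ : L.sectionsNear p => L.dTilde χ.1 p X ∈ L.fiber p) J_neg_J).mp h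

theorem apply_evalAt (hA : L.IsAL A) {p : M} (X : TSpace p) (ψ : L.sectionsNear p) :
    A p X (L.evalAt p ψ) = dTildeOneZeroAt hA.isHolomorphicCurve p X ψ :=
  (isAL_iff hA.isHolomorphicCurve).1 hA p X ψ

theorem isOneZeroPart (hA : L.IsAL A) : L.IsOneZeroPart A := fun U ψ hU hψ p hp X =>
  let ψ' : L.sectionsNear p := ⟨ψ, U, hU, hp, hψ⟩
  ⟨(dTildeAt hA.isHolomorphicCurve p (rot p X) ψ').2, congrArg Subtype.val (hA.apply_evalAt X ψ')⟩

theorem apply_rot (hA : L.IsAL A) {p : M} (X : TSpace p) (v : L.fiber p) :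
    A p (rot p X) v = L.J p (A p X v) := by
  obtain ⟨ψ, rfl⟩ := L.evalAt_surjective p v
  rw [hA.apply_evalAt, hA.apply_evalAt, dTildeOneZeroAt_rot]

theorem apply_J (hA : L.IsAL A) {p : M} (X : TSpace p) (v : L.fiber p) :
    A p X (L.J p v) = -L.J p (A p X v) := by
  obtain ⟨ψ, rfl⟩ := L.evalAt_surjective p v
  rw [← L.evalAt_JOnSections, hA.apply_evalAt, hA.apply_evalAt, dTildeOneZeroAt_JOnSections]

end IsAL

variable (L) in
theorem smoothFormOn_dTilde [IsManifold 𝓘(ℂ) ∞ M] {U : Set M} {ψ : ∀ q, L.fiber q}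
    (hU : IsOpen U) (hψ : L.SmoothSectionOn U ψ) : SmoothFormOn U (L.dTilde ψ) := by
  have : IsManifold 𝓘(ℝ, ℂ) ∞ M := isManifold_real
  have hdψ : SmoothFormOn U (diff fun q => (ψ q : H2)) := smoothFormOn_diff hU hψ
  have hdJψ : SmoothFormOn U fun p => (diff (fun q => (L.J q (ψ q) : H2)) p).comp (rot p) :=
    smoothFormOn_comp_rot (smoothFormOn_diff hU (L.J_smooth U ψ hU hψ))
  exact fun p₀ w => contMDiffOn_const_smul (1 / 2 : ℝ) ((hdψ p₀ w).add (hdJψ p₀ w))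

theorem IsAL.isKEndMinus [IsManifold 𝓘(ℂ) ∞ M] {A : L.EndForm} (hA : L.IsAL A) :
    L.IsKEndMinus A where
  type_K _ := hA.apply_rot
  anti _ := hA.apply_J
  smooth U ψ hU hψ p₀ w := by
    have hL := hA.isHolomorphicCurve
    have hV : IsOpen (U ∩ (chartAt ℂ p₀).source) := hU.inter (chartAt ℂ p₀).open_source
    have hD := L.smoothFormOn_dTilde hU hψ
    obtain ⟨χ, hχ, hχ_eq⟩ := L.exists_section_eqOn (hD p₀ (Complex.I * w)) fun q hq =>
      (dTildeAt hL q _ ⟨ψ, U, hU, hq.1, hψ⟩).2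
    refine (contMDiffOn_const_smul (1 / 2 : ℝ) ((hD p₀ w).sub (L.J_smooth _ χ hV hχ))).congr
      fun q hq => ?_
    let ψ' : L.sectionsNear q := ⟨ψ, U, hU, hq.1, hψ⟩
    have hχq : χ q = dTildeAt hL q (rot q (coordField p₀ w q)) ψ' :=
      Subtype.ext (by rw [hχ_eq q hq, rot_coordField p₀ w hq.2]; rfl)
    change (A q (coordField p₀ w q) (L.evalAt q ψ') : H2) = _
    rw [hA.apply_evalAt, dTildeOneZeroAt_apply, ← hχq]
    rfl

end HopfField

end ComplexQuaternionicLine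

namespace RightComplex

/-- Right multiplication by `i`, as a quaternionic scalar: it acts on the fibres of quaternionic
line subbundles, on which `RightComplex` itself does not act. -/
noncomputable abbrev rightI : ℍ[ℝ]ᵐᵒᵖ := MulOpposite.op (toQuaternion I)

theorem rightI_smul_rightI_smul {N : Type*} [AddCommGroup N] [Module ℍ[ℝ]ᵐᵒᵖ N] (v : N) :
    rightI • rightI • v = -v := by
  rw [smul_smul, ← MulOpposite.op_mul, ← map_mul, I_mul_I, map_neg, map_one, MulOpposite.op_neg,
    MulOpposite.op_one, neg_one_smul]

theorem toQuaternion_I : toQuaternion I = ⟨0, 1, 0, 0⟩ := rfl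

theorem exists_op_toQuaternion_eq_of_commute {c : ℍ[ℝ]ᵐᵒᵖ} (h : Commute c rightI) :
    ∃ z : RightComplex, MulOpposite.op (toQuaternion z) = c := by
  have h_unop : toQuaternion I * c.unop = c.unop * toQuaternion I := congrArg MulOpposite.unop h
  have hJ := congrArg QuaternionAlgebra.imJ h_unop
  have hK := congrArg QuaternionAlgebra.imK h_unop
  rw [Quaternion.imJ_mul, Quaternion.imJ_mul, toQuaternion_I] at hJ
  rw [Quaternion.imK_mul, Quaternion.imK_mul, toQuaternion_I] at hK
  dsimp only at hJ hK
  refine ⟨(⟨c.unop.re, c.unop.imI⟩ : ℂ),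
    MulOpposite.unop_injective (Quaternion.ext _ _ rfl rfl ?_ ?_)⟩
  · change 0 = c.unop.imJ
    linarith
  · change 0 = c.unop.imK
    linarith

theorem exists_not_commute_rightI : ∃ c : ℍ[ℝ]ᵐᵒᵖ, ¬Commute c rightI := by
  refine ⟨MulOpposite.op ⟨0, 0, 1, 0⟩, fun h => ?_⟩
  obtain ⟨z, hz⟩ := exists_op_toQuaternion_eq_of_commute h
  exact zero_ne_one (congrArg (fun c : ℍ[ℝ]ᵐᵒᵖ => c.unop.imJ) hz)

theorem commute_rightI_of_smul_comm {e : H2} (he : e ≠ 0) {c : ℍ[ℝ]ᵐᵒᵖ}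
    (h : c • rightI • e = rightI • c • e) : Commute c rightI :=
  smul_left_injective ℍ[ℝ]ᵐᵒᵖ he (by simpa only [mul_smul] using h)

end RightComplex

namespace ComplexQuaternionicLine

open RightComplex

variable {M : Type*} [TopologicalSpace M] [ChartedSpace ℂ M] (L : ComplexQuaternionicLine M)

/-- The subspace of the fibre of `L` on which `J` is the right multiplication by `i`. -/
noncomputable def eigenFiber (p : M) : Submodule RightComplex H2 where
  carrier := {v | ∃ hv : v ∈ L.fiber p, L.J p ⟨v, hv⟩ = rightI • ⟨v, hv⟩}
  add_mem' := by
    rintro v w ⟨hv, hJv⟩ ⟨hw, hJw⟩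
    exact ⟨add_mem hv hw, (map_add (L.J p) ⟨v, hv⟩ ⟨w, hw⟩).trans
      ((congrArg₂ (· + ·) hJv hJw).trans (smul_add rightI _ _).symm)⟩
  zero_mem' := ⟨zero_mem _, (map_zero (L.J p)).trans (smul_zero rightI).symm⟩
  smul_mem' := by
    rintro z v ⟨hv, hJv⟩
    refine ⟨(L.fiber p).smul_mem (MulOpposite.op (toQuaternion z)) hv,
      (map_smul (L.J p) _ ⟨v, hv⟩).trans ((congrArg _ hJv).trans (Subtype.ext ?_))⟩
    exact smul_comm z I v

variable {L} {p : M}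

theorem coe_mem_eigenFiber {v : L.fiber p} :
    (v : H2) ∈ L.eigenFiber p ↔ L.J p v = rightI • v :=
  ⟨fun ⟨_, h⟩ => h, fun h => ⟨v.2, h⟩⟩

theorem eigenFiber_eq_span_singleton {e : H2} (he : e ∈ L.eigenFiber p) (he0 : e ≠ 0) :
    L.eigenFiber p = Submodule.span RightComplex {e} := by
  refine le_antisymm (fun w ⟨hw, hJw⟩ => ?_) ((Submodule.span_singleton_le_iff_mem _ _).2 he)
  obtain ⟨heL, hJe⟩ := he
  obtain ⟨c, rfl⟩ := Submodule.mem_span_singleton.1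
    ((LineSubbundle.fiber_eq_span_singleton heL he0).le hw)
  have hce : c • rightI • (⟨e, heL⟩ : L.fiber p) = rightI • c • (⟨e, heL⟩ : L.fiber p) := by
    rw [← hJe, ← map_smul]
    exact hJw
  obtain ⟨z, rfl⟩ := exists_op_toQuaternion_eq_of_commute
    (commute_rightI_of_smul_comm he0 (congrArg Subtype.val hce))
  exact Submodule.mem_span_singleton.2 ⟨z, rfl⟩

theorem sub_rightI_smul_J_mem_eigenFiber (v : L.fiber p) :
    ((v - rightI • L.J p v : L.fiber p) : H2) ∈ L.eigenFiber p := by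
  have rightI_sq : rightI • rightI • L.J p v = -L.J p v := rightI_smul_rightI_smul (L.J p v)
  rw [coe_mem_eigenFiber, map_sub, map_smul, L.J_sq, smul_sub, rightI_sq, smul_neg,
    sub_neg_eq_add, sub_neg_eq_add, add_comm]

variable (L p)

theorem exists_sub_rightI_smul_J_ne_zero :
    ∃ v : L.fiber p, v - rightI • L.J p v ≠ 0 := by
  by_contra! h
  obtain ⟨e, he, he0⟩ := L.exists_mem_fiber_ne_zero p
  obtain ⟨c, hc⟩ := exists_not_commute_rightI
  have rightI_smul (v : L.fiber p) : rightI • v = -L.J p v :=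
    (congrArg (rightI • ·) (sub_eq_zero.1 (h v))).trans (rightI_smul_rightI_smul (L.J p v))
  have hce : c • rightI • (⟨e, he⟩ : L.fiber p) = rightI • c • (⟨e, he⟩ : L.fiber p) := by
    rw [rightI_smul, rightI_smul, map_smul, smul_neg]
  exact hc (commute_rightI_of_smul_comm he0 (congrArg Subtype.val hce))

/-- The complex line subbundle of `L` on which `J` is the right multiplication by `i`; it is the
inverse of the twistor projection. -/
noncomputable def eigenbundle : LineSubbundle RightComplex M where
  fiber := L.eigenFiber
  exists_frame p := by
    obtain ⟨v, hv⟩ := L.exists_sub_rightI_smul_J_ne_zero p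
    obtain ⟨ψ, rfl⟩ := L.evalAt_surjective p v
    obtain ⟨U, hU, hpU, hτ⟩ := (ψ - rightI • L.JOnSections p ψ).2
    let τ (q : M) : L.eigenFiber q := ⟨_, sub_rightI_smul_J_mem_eigenFiber (ψ.1 q)⟩
    have hτp : (τ p : H2) ≠ 0 := fun h => hv (Subtype.ext h)
    obtain ⟨V, hV0, hV, hpV⟩ := eventually_nhds_iff.1
      ((hτ.contMDiffAt (hU.mem_nhds hpU)).continuousAt.eventually_ne hτp)
    exact ⟨U ∩ V, hU.inter hV, ⟨hpU, hpV⟩, τ, hτ.mono Set.inter_subset_left, fun q hq =>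
      ⟨hV0 q hq.2, eigenFiber_eq_span_singleton (τ q).2 (hV0 q hq.2)⟩⟩

end ComplexQuaternionicLine

namespace ComplexQuaternionicLine

variable {M : Type*} [TopologicalSpace M] [ChartedSpace ℂ M]

theorem ext_of_fiber {L L' : ComplexQuaternionicLine M} (h : ∀ p, L.fiber p = L'.fiber p)
    (hJ : ∀ p v (hv : v ∈ L.fiber p) (hv' : v ∈ L'.fiber p),
      (L.J p ⟨v, hv⟩ : H2) = L'.J p ⟨v, hv'⟩) : L = L' := by
  obtain ⟨⟨fiber, _⟩, J, _, _⟩ := L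
  obtain ⟨⟨fiber', _⟩, J', _, _⟩ := L'
  obtain rfl : fiber = fiber' := funext h
  obtain rfl : J = J' := by
    funext p
    ext1 v
    exact Subtype.ext (hJ p v v.2 v.2)
  rfl

end ComplexQuaternionicLine

namespace LineSubbundle

open ComplexQuaternionicLine RightComplex

variable {M : Type*} [TopologicalSpace M] [ChartedSpace ℂ M] (E : LineSubbundle RightComplex M)
  {p : M}

/-- The inclusion of `E` in its twistor projection. -/
noncomputable def toTwistor (v : E.fiber p) : E.twistorProjection.fiber p := E.incl v

/-- The local sections of `E`, seen as sections of its twistor projection. -/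
noncomputable def toTwistorSection (φ : E.sectionsNear p) :
    E.twistorProjection.sectionsNear p :=
  ⟨fun q => E.toTwistor (φ.1 q), φ.2⟩

theorem J_toTwistor (v : E.fiber p) :
    E.twistorProjection.J p (E.toTwistor v) = rightI • E.toTwistor v :=
  E.twistorJ_incl v

theorem JOnSections_toTwistorSection (φ : E.sectionsNear p) :
    E.twistorProjection.JOnSections p (E.toTwistorSection φ) = rightI • E.toTwistorSection φ :=
  Subtype.ext (funext fun q => E.J_toTwistor (φ.1 q))

theorem eigenFiber_twistorProjection (p : M) : E.twistorProjection.eigenFiber p = E.fiber p := by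
  obtain ⟨e, he, he0⟩ := E.exists_mem_fiber_ne_zero p
  rw [fiber_eq_span_singleton he he0]
  exact eigenFiber_eq_span_singleton ⟨E.mem_quaternionicSpan ⟨e, he⟩, E.J_toTwistor ⟨e, he⟩⟩ he0

variable {E}

theorem twistorProjection_hom_ext {N : Type*} [AddCommMonoid N] [Module ℍ[ℝ]ᵐᵒᵖ N]
    {f g : E.twistorProjection.fiber p →ₗ[ℍ[ℝ]ᵐᵒᵖ] N}
    (h : ∀ v : E.fiber p, f (E.toTwistor v) = g (E.toTwistor v)) : f = g := by
  obtain ⟨e, he, he0⟩ := E.exists_mem_fiber_ne_zero p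
  ext1 v
  obtain ⟨c, hc⟩ := Submodule.mem_span_singleton.1
    ((fiber_eq_span_singleton (E.mem_quaternionicSpan ⟨e, he⟩) he0).le v.2)
  obtain rfl : c • E.toTwistor ⟨e, he⟩ = v := Subtype.ext hc
  rw [map_smul, map_smul, h]

theorem twistorProjection_eigenbundle (L : ComplexQuaternionicLine M) :
    L.eigenbundle.twistorProjection = L := by
  have hfiber (p : M) : L.eigenbundle.twistorProjection.fiber p = L.fiber p := by
    obtain ⟨e, he, he0⟩ := L.eigenbundle.exists_mem_fiber_ne_zero p
    rw [fiber_eq_span_singleton he.1 he0]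
    exact fiber_eq_span_singleton (L.eigenbundle.mem_quaternionicSpan ⟨e, he⟩) he0
  refine ext_of_fiber hfiber fun p v hv _ => ?_
  let i : L.eigenbundle.twistorProjection.fiber p →ₗ[ℍ[ℝ]ᵐᵒᵖ] L.fiber p :=
    Submodule.inclusion (hfiber p).le
  have hJ : i.comp (L.eigenbundle.twistorProjection.J p) = (L.J p).comp i :=
    twistorProjection_hom_ext fun w =>
      (congrArg i (L.eigenbundle.J_toTwistor w)).trans
        (coe_mem_eigenFiber (v := ⟨w, w.2.1⟩) |>.1 w.2).symm
  exact congrArg Subtype.val (LinearMap.congr_fun hJ ⟨v, hv⟩)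

theorem halfDelta_apply (X : TSpace p) (v : E.fiber p) : E.halfDelta p X v =
    (1 / 2 : ℝ) • (E.delta p X v + E.delta p (rot p X) (I • v)) := rfl

theorem halfDelta_evalAt (X : TSpace p) (φ : E.sectionsNear p) :
    E.halfDelta p X (E.evalAt p φ) =
      (E.fiber p).mkQ (E.twistorProjection.dTilde (E.toTwistorSection φ).1 p X) := by
  rw [halfDelta_apply, ← map_smul (E.evalAt p), delta_evalAt, delta_evalAt, ← map_add,
    ← LinearMap.map_smul_of_tower]
  refine congrArg (E.fiber p).mkQ ?_
  rw [dTilde_apply, JOnSections_toTwistorSection]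
  rfl

theorem isHolomorphicCurve_twistorProjection_iff :
    E.twistorProjection.IsHolomorphicCurve ↔ ∀ (p : M) (X : TSpace p) (v : E.fiber p),
      ∃ w ∈ E.twistorProjection.fiber p, E.halfDelta p X v = (E.fiber p).mkQ w := by
  refine ⟨fun hL p X v => ?_, fun h => ?_⟩
  · obtain ⟨φ, rfl⟩ := E.evalAt_surjective p v
    exact ⟨_, E.twistorProjection.isHolomorphicCurve_iff_dTilde_mem.1 hL p X _,
      halfDelta_evalAt X φ⟩
  · refine E.twistorProjection.isHolomorphicCurve_iff_delta_rot_J.2 fun p X => ?_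
    suffices hδ : (E.twistorProjection.delta p (rot p X)).comp (E.twistorProjection.J p) =
        -E.twistorProjection.delta p X from LinearMap.congr_fun hδ
    refine twistorProjection_hom_ext fun v => ?_
    obtain ⟨φ, rfl⟩ := E.evalAt_surjective p v
    refine (E.twistorProjection.dTilde_mem_iff (E.toTwistorSection φ) X).1 ?_
    obtain ⟨w, hw, hφw⟩ := h p X (E.evalAt p φ)
    rw [halfDelta_evalAt] at hφw
    exact (Submodule.sub_mem_iff_left _ hw).1
      (E.mem_quaternionicSpan ⟨_, (Submodule.Quotient.eq _).1 hφw⟩)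

theorem halfDelta_eq_mkQ {A : E.twistorProjection.EndForm} (hA : E.twistorProjection.IsAL A)
    (X : TSpace p) (v : E.fiber p) :
    E.halfDelta p X v = (E.fiber p).mkQ (A p X (E.toTwistor v) : H2) := by
  obtain ⟨φ, rfl⟩ := E.evalAt_surjective p v
  have hL := hA.isHolomorphicCurve
  set D := dTildeAt hL p X (E.toTwistorSection φ) with hD
  have dTildeAt_rot : dTildeAt hL p (rot p X) (E.toTwistorSection φ) = -(rightI • D) := by
    rw [hD, ← map_smul, ← JOnSections_toTwistorSection, dTildeAt_JOnSections, neg_neg]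
  have sub_eq : D - A p X (E.toTwistor (E.evalAt p φ)) =
      (1 / 2 : ℝ) • (D - rightI • E.twistorProjection.J p D) := by
    change D - A p X (E.twistorProjection.evalAt p (E.toTwistorSection φ)) = _
    rw [hA.apply_evalAt, dTildeOneZeroAt_apply, ← hD, dTildeAt_rot, map_neg, map_smul]
    generalize rightI • E.twistorProjection.J p D = u
    module
  rw [halfDelta_evalAt]
  refine (Submodule.Quotient.eq _).2 ?_
  rw [← coe_dTildeAt hL, ← Submodule.coe_sub, ← hD, sub_eq, ← E.eigenFiber_twistorProjection]
  exact ((E.twistorProjection.eigenFiber p).restrictScalars ℝ).smul_mem _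
    (sub_rightI_smul_J_mem_eigenFiber D)

theorem halfDelta_eq_zero_iff {A : E.twistorProjection.EndForm}
    (hA : E.twistorProjection.IsAL A) : E.halfDelta p = 0 ↔ A p = 0 := by
  refine ⟨fun h => ?_, fun h => ?_⟩
  · ext1 X
    refine twistorProjection_hom_ext fun v => ?_
    set a := A p X (E.toTwistor v) with ha
    have ha_mem : (a : H2) ∈ E.twistorProjection.eigenFiber p := by
      rw [E.eigenFiber_twistorProjection, ← Submodule.Quotient.mk_eq_zero, ← Submodule.mkQ_apply,
        ha, ← halfDelta_eq_mkQ hA, h]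
      rfl
    have hJa : E.twistorProjection.J p a = -E.twistorProjection.J p a := by
      rw [ha, ← hA.apply_J, J_toTwistor, map_smul, ← ha, coe_mem_eigenFiber.1 ha_mem]
    have hJa0 : E.twistorProjection.J p a = 0 := by
      rwa [← add_eq_zero_iff_eq_neg, ← two_smul ℝ, smul_eq_zero_iff_right two_ne_zero] at hJa
    have ha0 : -a = 0 := by rw [← E.twistorProjection.J_sq p a, hJa0, map_zero]
    exact neg_eq_zero.1 ha0
  · ext1 X
    ext1 v
    rw [halfDelta_eq_mkQ hA, h]
    exact map_zero _

theorem isHolomorphicCurve_iff_halfDelta_eq_zero :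
    E.IsHolomorphicCurve ↔ ∀ p : M, E.halfDelta p = 0 := by
  have I_smul_I_smul {p : M} (v : E.fiber p) : I • I • v = -v :=
    Subtype.ext (rightI_smul_rightI_smul (v : H2))
  refine ⟨fun hE p => ?_, fun h p X v => ?_⟩
  · ext1 X
    ext1 v
    rw [halfDelta_apply, hE, I_smul_I_smul, map_neg, add_neg_cancel, smul_zero]
    rfl
  · have hv : E.halfDelta p X (I • v) = 0 := by rw [h]; rfl
    rw [halfDelta_apply, I_smul_I_smul, map_neg, smul_eq_zero_iff_right (by norm_num),
      ← sub_eq_add_neg, sub_eq_zero] at hv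
    exact hv.symm

theorem isHolomorphicCurve_iff_exists_isAL :
    E.IsHolomorphicCurve ↔
      ∃ A : E.twistorProjection.EndForm, E.twistorProjection.IsAL A ∧ ∀ p : M, A p = 0 := by
  rw [isHolomorphicCurve_iff_halfDelta_eq_zero]
  refine ⟨fun h => ?_, fun ⟨A, hA, hA0⟩ p => (halfDelta_eq_zero_iff hA).2 (hA0 p)⟩
  have hL : E.twistorProjection.IsHolomorphicCurve :=
    isHolomorphicCurve_twistorProjection_iff.2 fun p X v =>
      ⟨0, zero_mem _, by rw [h, map_zero]; rfl⟩
  obtain ⟨A, hA, -⟩ := existsUnique_isAL hL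
  exact ⟨A, hA, fun p => (halfDelta_eq_zero_iff hA).1 (h p)⟩

theorem exists_twistorProjection_eq_iff {L : ComplexQuaternionicLine M} :
    (∃ E : LineSubbundle RightComplex M, E.IsHolomorphicCurve ∧ E.twistorProjection = L) ↔
      L.IsHolomorphicCurve ∧ ∃ A : L.EndForm, L.IsAL A ∧ ∀ p : M, A p = 0 := by
  constructor
  · rintro ⟨E, hE, rfl⟩
    obtain ⟨A, hA, hA0⟩ := isHolomorphicCurve_iff_exists_isAL.1 hE
    exact ⟨hA.isHolomorphicCurve, A, hA, hA0⟩
  · rintro ⟨-, hA⟩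
    refine ⟨L.eigenbundle, isHolomorphicCurve_iff_exists_isAL.2 ?_,
      twistorProjection_eigenbundle L⟩
    rwa [twistorProjection_eigenbundle]

end LineSubbundle

namespace IsComplexStructure

variable {M : Type*} [TopologicalSpace M] [ChartedSpace ℂ M] {S : M → (H2 →L[ℝ] H2)}
  (hS : IsComplexStructure S)

include hS

theorem mdifferentiableAt (p : M) : MDifferentiableAt 𝓘(ℝ, ℂ) 𝓘(ℝ, H2 →L[ℝ] H2) S p :=
  hS.smooth.contMDiffAt.mdifferentiableAt (by simp)

theorem diff_smul (p : M) (X : TSpace p) (c : ℍ[ℝ]ᵐᵒᵖ) (v : H2) :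
    diff S p X (c • v) = c • diff S p X v := by
  have hleft := diff_clm_comp (ContinuousLinearMap.apply ℝ H2 (c • v)) (hS.mdifferentiableAt p) X
  have hright := diff_clm_comp ((smulCLM c).comp (ContinuousLinearMap.apply ℝ H2 v))
    (hS.mdifferentiableAt p) X
  have hlinear : (fun q => ContinuousLinearMap.apply ℝ H2 (c • v) (S q)) =
      fun q => ((smulCLM c).comp (ContinuousLinearMap.apply ℝ H2 v)) (S q) :=
    funext fun q => hS.linear q c v
  exact hleft.symm.trans ((congrArg (fun f => diff f p X) hlinear).trans hright)

theorem diff_comp (p : M) (X : TSpace p) :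
    (diff S p X).comp (S p) = -(S p).comp (diff S p X) := by
  have leibniz := diff_clm_apply₂ (ContinuousLinearMap.compL ℝ H2 H2 H2) (hS.mdifferentiableAt p)
    (hS.mdifferentiableAt p) X
  have sq_eq : (fun q => ContinuousLinearMap.compL ℝ H2 H2 H2 (S q) (S q)) =
      fun _ => -ContinuousLinearMap.id ℝ H2 := by
    funext q
    ext1 v
    exact hS.sq q v
  rw [sq_eq, diff_apply_of_hasMFDerivAt (hasMFDerivAt_const _ _)] at leibniz
  exact eq_neg_of_add_eq_zero_right leibniz.symm

theorem comp_comp_self (p : M) (T : H2 →L[ℝ] H2) : (S p).comp ((S p).comp T) = -T :=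
  ContinuousLinearMap.ext fun v => hS.sq p (T v)

omit hS in
theorem hopfA_apply (p : M) (X : TSpace p) :
    hopfA S p X = (1 / 4 : ℝ) • ((S p).comp (diff S p X) + diff S p (rot p X)) := rfl

theorem smoothFormOn_hopfA [IsManifold 𝓘(ℂ) ∞ M] :
      SmoothFormOn (F := H2 →L[ℝ] H2) Set.univ (hopfA S) := by
  have : IsManifold 𝓘(ℝ, ℂ) ∞ M := isManifold_real
  have hdS : SmoothFormOn Set.univ (diff S) := smoothFormOn_diff isOpen_univ hS.smooth.contMDiffOn
  exact fun p₀ w => contMDiffOn_const_smul (1 / 4)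
    ((hS.smooth.contMDiffOn.clm_comp (hdS p₀ w)).add (smoothFormOn_comp_rot hdS p₀ w))

theorem isKEndMinusH_hopfA [IsManifold 𝓘(ℂ) ∞ M] : IsKEndMinusH S (hopfA S) where
  smooth := hS.smoothFormOn_hopfA
  linear p X c v := by
    simp only [hopfA_apply, smul_apply, add_apply, ContinuousLinearMap.comp_apply,
      hS.diff_smul, hS.linear, smul_add, smul_comm c]
  type_K p X := by
    rw [hopfA_apply, hopfA_apply, rot_rot, map_neg, ContinuousLinearMap.comp_smul,
      ContinuousLinearMap.comp_add, hS.comp_comp_self, add_comm]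
  anti p X := by
    rw [hopfA_apply, ContinuousLinearMap.smul_comp, ContinuousLinearMap.add_comp,
      ContinuousLinearMap.comp_assoc, hS.diff_comp, hS.diff_comp, ContinuousLinearMap.comp_smul,
      ContinuousLinearMap.comp_add, ContinuousLinearMap.comp_neg, ← neg_add]
    exact smul_neg _ _

end IsComplexStructure

namespace ComplexQuaternionicLine

variable {M : Type*} [TopologicalSpace M] [ChartedSpace ℂ M] {L : ComplexQuaternionicLine M}

theorem IsAL.hopfA_eq {S : M → (H2 →L[ℝ] H2)} {A : L.EndForm} (hA : L.IsAL A)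
    (hS : IsComplexStructure S) (hJ : ∀ (p : M) (v : L.fiber p), (L.J p v : H2) = S p v) {p : M}
    (X : TSpace p) (v : L.fiber p) : hopfA S p X v = (A p X v : H2) := by
  obtain ⟨ψ, rfl⟩ := L.evalAt_surjective p v
  have diffAt_J (Y : TSpace p) : L.diffAt p Y (L.JOnSections p ψ) =
      S p (L.diffAt p Y ψ) + diff S p Y (ψ.1 p) := by
    have hJψ : (fun q => ((L.JOnSections p ψ).1 q : H2)) = fun q => S q (ψ.1 q) :=
      funext fun q => hJ q (ψ.1 q)
    rw [LineSubbundle.diffAt_apply, hJψ]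
    exact diff_clm_apply₂ (ContinuousLinearMap.id ℝ (H2 →L[ℝ] H2)) (hS.mdifferentiableAt p)
      (LineSubbundle.mdifferentiableAt_of_mem_sectionsNear ψ.2) Y
  have coe_A : (A p X (L.evalAt p ψ) : H2) =
      (1 / 2 : ℝ) • (L.dTilde ψ.1 p X - S p (L.dTilde ψ.1 p (rot p X))) := by
    rw [hA.apply_evalAt, dTildeOneZeroAt_apply, ← coe_dTildeAt hA.isHolomorphicCurve,
      ← coe_dTildeAt hA.isHolomorphicCurve, ← hJ]
    rfl
  have evalAt_eq : (L.evalAt p ψ : H2) = ψ.1 p := rfl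
  rw [coe_A, evalAt_eq, dTilde_apply, dTilde_apply, diffAt_J, diffAt_J, rot_rot,
    IsComplexStructure.hopfA_apply]
  simp only [map_neg, map_smul, map_add, hS.sq, LinearMap.neg_apply, neg_apply, smul_apply,
    add_apply, ContinuousLinearMap.comp_apply]
  module

end ComplexQuaternionicLine

theorem mainTheorem5_general {M : Type*} [TopologicalSpace M] [ChartedSpace ℂ M]
    [IsManifold 𝓘(ℂ) ∞ M] :
    (∀ E : LineSubbundle RightComplex M,
      E.twistorProjection.IsHolomorphicCurve ↔
        ∀ (p : M) (X : TSpace p) (v : E.fiber p),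
          ∃ w ∈ E.twistorProjection.fiber p, E.halfDelta p X v = (E.fiber p).mkQ w) ∧
    (∀ L : ComplexQuaternionicLine M, L.IsHolomorphicCurve →
      (∀ (U : Set M) (ψ : ∀ q, L.fiber q), IsOpen U → L.SmoothSectionOn U ψ →
        (∀ p ∈ U, ∀ X : TSpace p, L.dTilde ψ p X ∈ L.fiber p) ∧ SmoothFormOn U (L.dTilde ψ)) ∧
      (∃! A_L : L.EndForm, L.IsAL A_L) ∧
      ∀ A_L : L.EndForm, L.IsAL A_L → L.IsOneZeroPart A_L ∧ L.IsKEndMinus A_L) ∧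
    (∀ (E : LineSubbundle RightComplex M) (A_L : E.twistorProjection.EndForm),
      E.twistorProjection.IsAL A_L →
        (∀ (p : M) (X : TSpace p) (v : E.fiber p),
          E.halfDelta p X v = (E.fiber p).mkQ (A_L p X (E.incl v) : H2)) ∧
        ((∀ p : M, E.halfDelta p = 0) ↔ ∀ p : M, A_L p = 0)) ∧
    (∀ L : ComplexQuaternionicLine M,
      (∃ E : LineSubbundle RightComplex M, E.IsHolomorphicCurve ∧ E.twistorProjection = L) ↔
        L.IsHolomorphicCurve ∧ ∃ A_L : L.EndForm, L.IsAL A_L ∧ ∀ p : M, A_L p = 0) ∧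
    (∀ S : M → (H2 →L[ℝ] H2), IsComplexStructure S → IsKEndMinusH S (hopfA S)) ∧
    (∀ (L : ComplexQuaternionicLine M) (S : M → (H2 →L[ℝ] H2)), IsComplexStructure S →
      (∀ (p : M) (v : L.fiber p), (L.J p v : H2) = S p v) →
        ∀ A_L : L.EndForm, L.IsAL A_L →
          ∀ (p : M) (X : TSpace p) (v : L.fiber p), hopfA S p X v = (A_L p X v : H2)) := by
  refine ⟨fun E => LineSubbundle.isHolomorphicCurve_twistorProjection_iff, fun L hL => ⟨?_, ?_, ?_⟩,
    fun E A_L hA => ⟨?_, ?_⟩, ?_, ?_, ?_⟩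
  · exact fun U ψ hU hψ =>
      ⟨fun p hp X => L.isHolomorphicCurve_iff_dTilde_mem.1 hL p X ⟨ψ, U, hU, hp, hψ⟩,
        L.smoothFormOn_dTilde hU hψ⟩
  · exact ComplexQuaternionicLine.existsUnique_isAL hL
  · exact fun A_L hA => ⟨hA.isOneZeroPart, hA.isKEndMinus⟩
  · exact fun p X v => LineSubbundle.halfDelta_eq_mkQ hA X v
  · exact forall_congr' fun p => LineSubbundle.halfDelta_eq_zero_iff hA
  · exact fun L => LineSubbundle.exists_twistorProjection_eq_iff
  · exact fun S hS => hS.isKEndMinusH_hopfA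
  · exact fun L S hS hJ A_L hA p X v => hA.hopfA_eq hS hJ X v

theorem mainTheorem5 {M : Type*} [TopologicalSpace M] [T2Space M] [ChartedSpace ℂ M]
    [IsManifold 𝓘(ℂ) ω M] :
    -- (i) the twistor projection of `E` is holomorphic iff `½ (δ_E + *δ_E J_E)` has values
    -- in `Hom(E, L/E)`
    (∀ E : LineSubbundle RightComplex M,
      E.twistorProjection.IsHolomorphicCurve ↔
        ∀ (p : M) (X : TSpace p) (v : E.fiber p),
          ∃ w ∈ E.twistorProjection.fiber p, E.halfDelta p X v = (E.fiber p).mkQ w) ∧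
    -- `D̃ : Γ(L) → Ω¹(L)`, and `A_L` exists, is the `(1,0)`-part of `D̃`, and is in `Γ(K End₋(L))`
    (∀ L : ComplexQuaternionicLine M, L.IsHolomorphicCurve →
      (∀ (U : Set M) (ψ : ∀ q, L.fiber q), IsOpen U → L.SmoothSectionOn U ψ →
        (∀ p ∈ U, ∀ X : TSpace p, L.dTilde ψ p X ∈ L.fiber p) ∧ SmoothFormOn U (L.dTilde ψ)) ∧
      (∃! A_L : L.EndForm, L.IsAL A_L) ∧
      ∀ A_L : L.EndForm, L.IsAL A_L → L.IsOneZeroPart A_L ∧ L.IsKEndMinus A_L) ∧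
    -- (ii)
    (∀ E : LineSubbundle RightComplex M, E.twistorProjection.IsHolomorphicCurve →
      ∀ A_L : E.twistorProjection.EndForm, E.twistorProjection.IsAL A_L →
        (∀ (p : M) (X : TSpace p) (v : E.fiber p),
          E.halfDelta p X v = (E.fiber p).mkQ (A_L p X (E.incl v) : H2)) ∧
        ((∀ p : M, E.halfDelta p = 0) ↔ ∀ p : M, A_L p = 0)) ∧
    -- twistor projections of holomorphic curves in `ℂP³` are exactly the holomorphic curves in
    -- `ℍP¹` with `A_L = 0`
    (∀ L : ComplexQuaternionicLine M,
      (∃ E : LineSubbundle RightComplex M, E.IsHolomorphicCurve ∧ E.twistorProjection = L) ↔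
        L.IsHolomorphicCurve ∧ ∃ A_L : L.EndForm, L.IsAL A_L ∧ ∀ p : M, A_L p = 0) ∧
    -- (iii)
    (∀ (L : ComplexQuaternionicLine M) (S : M → (H2 →L[ℝ] H2)),
      L.IsHolomorphicCurve → L.IsImmersed → IsMeanCurvatureSphere L.toLineSubbundle S →
      (∀ (p : M) (v : L.fiber p), (L.J p v : H2) = S p v) →
        IsKEndMinusH S (hopfA S) ∧
        ∀ A_L : L.EndForm, L.IsAL A_L →
          ∀ (p : M) (X : TSpace p) (v : L.fiber p), hopfA S p X v = (A_L p X v : H2)) := by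
  obtain ⟨twistor_iff, dTilde, halfDelta_eq, twistor_iff_A_eq_zero, hopfA, hopfA_eq⟩ :=
    mainTheorem5_general (M := M)
  exact ⟨twistor_iff, dTilde, fun E _ => halfDelta_eq E, twistor_iff_A_eq_zero, fun L S _ _ hS hJ =>
    ⟨hopfA S hS.toIsComplexStructure, hopfA_eq L S hS.toIsComplexStructure hJ⟩⟩
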